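/- Let $n\ge 1$. An instance consists of $n$ agents and $n$ items located at $2n$ pairwise distinct points of the real line; $d(a,g)$ is the distance between agent $a$ and item $g$. An ordinal profile $\succ$ consists of a strict ranking $\succ_a$ of all items for each agent $a$; an instance is consistent with it if $g\succ_a h$ implies $d(a,g)\le d(a,h)$. For $1\le k\le n$, the $k$-centrum cost $\mathrm{SC}_k(M\mid d)$ of a matching (bijection) $M$ of items to agents is the sum of the $k$ largest among the $n$ distances $d(a,M(a))$. A deterministic (randomized) ordinal algorithm $\mathrm{ALG}$ maps each profile to a matching (a probability distribution over matchings), and its distortion with respect to $\mathrm{SC}_k$ is $\sup_{\succ}\sup_{d}\ \mathbb E[\mathrm{SC}_k(\mathrm{ALG}(\succ)\mid d)]/\min_M \mathrm{SC}_k(M\mid d)$, where $d$ ranges over the instances consistent with $\succ$. OrderMatch is the following procedure on profiles that are consistent with some instance. Let $G_+$ be the set of items that are the favorite of at least one agent, and let $g_\ell,g_r$ (possibly equal) be the items that are ranked last within $G_+$ by some agent. For agents $a_i,a_j$ with favorite items $g_\ell$ and $g_r$ let $G_{\rm in}(a_i,a_j)=\{g: g\succ_{a_i} g_r\text{ or }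 g\succ_{a_j} g_\ell\}$; choose such a pair $(a_\ell,a_r)$ that maximizes $|G_{\rm in}(a_i,a_j)|$ and put $G_{\rm in}=G_{\rm in}(a_\ell,a_r)$. Let $\pi_g$ be the ordering of $G_{\rm in}$ induced by a left-to-right ordering of all items, with $g_\ell$ not to the right of $g_r$, for which all agents' rankings are single-peaked (of any three items, no agent ranks the middle one below both others). Let $\pi_a$ be an ordering of all agents in which $a$ precedes $b$ whenever the favorite item of $a$ precedes that of $b$ in $\pi_g$. Match the $i$-th item of $\pi_g$ to the $i$-th agent of $\pi_a$ for $i\le|G_{\rm in}|$, and match the remaining items to the remaining agents arbitrarily. All choices and ties may be resolved arbitrarily, as functions of the profile. Theorem. (1) OrderMatch is well defined: all its steps can be carried out on every profile that is consistent with some instance; and in every instance consistent with the profile, $\pi_g$ is, up to reversal, the true left-to-right order of the items in $G_{\rm in}$. (2) However its choices are resolved, OrderMatch has distortion at most $3$ with respect to $\mathrm{SC}_k$ simultaneously for every $k\in\{1,\dots,n\}$; this covers the egalitarian ($k=1$) and the utilitarian ($k=n$) cost. (3) This is best possible: for every $k\in\{1,\dots,n\}$, every deterministic ordinal algorithm has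 distortion at least $3$ with respect to $\mathrm{SC}_k$ if $n\ge2$, and every randomized ordinal algorithm has distortion at least $3-2/n$. -/

import Mathlib

open scoped ENNReal

noncomputable section

namespace LineMatching

/-- The `n` agents. -/
abbrev Agent (n : ℕ) : Type := Fin n

/-- The `n` items. -/
abbrev Item (n : ℕ) : Type := Fin n

/-- A one-to-one matching of the items to the agents; `M a` is the item matched to agent `a`. -/
abbrev Matching (n : ℕ) : Type := Agent n ≃ Item n

/-- An ordinal profile: each agent ranks all items strictly. `P a g` is the rank of item `g` for
agent `a`; rank `0` is the best. -/
abbrev Profile (n : ℕ) : Type := Agent n → (Item n ≃ Fin n)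

/-- `g ≻_a h`. -/
def Prefers {n : ℕ} (P : Profile n) (a : Agent n) (g h : Item n) : Prop := P a g < P a h

/-- `g` is the favorite item `top(a)` of agent `a`. -/
def IsTop {n : ℕ} (P : Profile n) (a : Agent n) (g : Item n) : Prop :=
  ∀ h : Item n, h ≠ g → Prefers P a g h

/-- Locations of the agents and items on the real line, all of them distinct. -/
structure LineInstance (n : ℕ) where
  agentPos : Agent n → ℝ
  itemPos : Item n → ℝ
  agent_injective : Function.Injective agentPos
  item_injective : Function.Injective itemPos
  agent_ne_item : ∀ a g, agentPos a ≠ itemPos g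

/-- The distance between an agent and an item. -/
def LineInstance.d {n : ℕ} (I : LineInstance n) (a : Agent n) (g : Item n) : ℝ :=
  |I.agentPos a - I.itemPos g|

/-- The line metric is consistent with the profile: `g ≻_a h` implies `d(a,g) ≤ d(a,h)`.
Ties in distance may be broken in any way. -/
def Consistent {n : ℕ} (I : LineInstance n) (P : Profile n) : Prop :=
  ∀ (a : Agent n) (g h : Item n), Prefers P a g h → I.d a g ≤ I.d a h

/-- The `k`-centrum cost: the sum of the `k` largest distances between agents and their items. -/
def centrumCost {n : ℕ} (k : ℕ) (I : LineInstance n) (M : Matching n) : ℝ :=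
  ((((Finset.univ : Finset (Agent n)).val.map fun a => I.d a (M a)).sort (· ≥ ·)).take k).sum

/-- The minimum `k`-centrum cost over all matchings. -/
def optCost {n : ℕ} (k : ℕ) (I : LineInstance n) : ℝ :=
  (Finset.univ : Finset (Matching n)).inf' ⟨Equiv.refl (Fin n), Finset.mem_univ _⟩
    (centrumCost k I)

/-- A deterministic (ordinal) algorithm maps every profile to a matching. -/
abbrev Algorithm (n : ℕ) : Type := Profile n → Matching n

/-- A randomized (ordinal) algorithm maps every profile to a distribution over matchings. -/
abbrev RandomizedAlgorithm (n : ℕ) : Type := Profile n → PMF (Matching n)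

/-- The distortion of a deterministic algorithm with respect to the `k`-centrum cost. -/
def distortion {n : ℕ} (k : ℕ) (ALG : Algorithm n) : ℝ≥0∞ :=
  ⨆ (P : Profile n) (I : LineInstance n) (_ : Consistent I P),
    ENNReal.ofReal (centrumCost k I (ALG P) / optCost k I)

/-- The expected `k`-centrum cost of a random matching. -/
def expectedCentrumCost {n : ℕ} (k : ℕ) (I : LineInstance n) (μ : PMF (Matching n)) : ℝ :=
  ∑ M : Matching n, (μ M).toReal * centrumCost k I M

/-- The distortion of a randomized algorithm with respect to the (expected) `k`-centrum cost. -/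
def randomizedDistortion {n : ℕ} (k : ℕ) (ALG : RandomizedAlgorithm n) : ℝ≥0∞ :=
  ⨆ (P : Profile n) (I : LineInstance n) (_ : Consistent I P),
    ENNReal.ofReal (expectedCentrumCost k I (ALG P) / optCost k I)

open Classical in
/-- The plurality score of an item. -/
def plu {n : ℕ} (P : Profile n) (g : Item n) : ℕ :=
  (Finset.univ.filter fun a : Agent n => IsTop P a g).card

open Classical in
/-- `G₊`, the items with positive plurality score. -/
def Gplus {n : ℕ} (P : Profile n) : Finset (Item n) :=
  Finset.univ.filter fun g => 1 ≤ plu P g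

/-- Some agent ranks `g` last among the items of `G₊`. -/
def LastInGplus {n : ℕ} (P : Profile n) (g : Item n) : Prop :=
  g ∈ Gplus P ∧ ∃ a : Agent n, ∀ h ∈ Gplus P, h ≠ g → Prefers P a h g

open Classical in
/-- `G_in(a_i, a_j) = {g : g ≻_{a_i} g_r or g ≻_{a_j} g_ℓ}`. -/
def Gin {n : ℕ} (P : Profile n) (gl gr : Item n) (ai aj : Agent n) : Finset (Item n) :=
  Finset.univ.filter fun g => Prefers P ai g gr ∨ Prefers P aj g gl

/-- `axis` (listing the items from left to right; `axis g` is the place of `g`) is an order with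
respect to which all agents have single-peaked preferences: of three items, no agent ranks
the middle one last. -/
def IsSinglePeakedAxis {n : ℕ} (P : Profile n) (axis : Item n ≃ Fin n) : Prop :=
  ∀ (a : Agent n) (x y z : Item n), axis x < axis y → axis y < axis z →
    Prefers P a y x ∨ Prefers P a y z

/-- A run of OrderMatch on the profile `P`. All choices that the algorithm makes arbitrarily are
left open, so that a profile may have many runs. Everything here depends on the profile only. -/
structure OrderMatchRun {n : ℕ} (P : Profile n) where
  /-- the extreme items: the items that are ranked last in `G₊` by some agent -/
  gl : Item n
  gr : Item n
  extreme : ∀ g : Item n, LastInGplus P g ↔ g = gl ∨ g = gr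
  /-- two agents with favorite items `gl` and `gr` that maximize the size of `G_in` -/
  al : Agent n
  ar : Agent n
  top_al : IsTop P al gl
  top_ar : IsTop P ar gr
  maximal : ∀ ai aj : Agent n, IsTop P ai gl → IsTop P aj gr →
    (Gin P gl gr ai aj).card ≤ (Gin P gl gr al ar).card
  /-- the ordering `π_g` of the items in `G_in`: these items as they are ordered by a left-to-right
  order of the items for which the profile is single-peaked -/
  axis : Item n ≃ Fin n
  singlePeaked : IsSinglePeakedAxis P axis
  gl_le_gr : axis gl ≤ axis gr
  itemOrder : List (Item n)
  mem_itemOrder : ∀ g : Item n, g ∈ itemOrder ↔ g ∈ Gin P gl gr al ar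
  sorted_itemOrder : itemOrder.Pairwise fun g h => axis g < axis h
  /-- the ordering `π_a` of all agents: by the place of their favorite item in `π_g`, ties being
  broken arbitrarily; `agentOrder i` is the agent at place `i` -/
  agentOrder : Fin n ≃ Agent n
  agentOrder_spec : ∀ (a b : Agent n) (i j : Fin itemOrder.length),
    IsTop P a itemOrder[i] → IsTop P b itemOrder[j] → i < j →
      agentOrder.symm a < agentOrder.symm b
  /-- the matching returned: the `i`-th item of `π_g` goes to the `i`-th agent of `π_a`, and the
  remaining items are matched arbitrarily to the remaining agents -/
  matching : Matching n
  matching_spec : ∀ (i : Fin n) (h : (i : ℕ) < itemOrder.length),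
    matching (agentOrder i) = itemOrder[(i : ℕ)]

/-- The algorithm `ALG` is an implementation of OrderMatch: on every profile that some line metric
is consistent with, it returns the matching of a run of OrderMatch. -/
def IsOrderMatch {n : ℕ} (ALG : Algorithm n) : Prop :=
  ∀ P : Profile n, (∃ I : LineInstance n, Consistent I P) →
    ∃ R : OrderMatchRun P, R.matching = ALG P

/-- The list of items is in its true order on the line, up to reversal. -/
def IsTrueOrder {n : ℕ} (I : LineInstance n) (L : List (Item n)) : Prop :=
  L.Pairwise (fun g h => I.itemPos g < I.itemPos h) ∨
    L.Pairwise (fun g h => I.itemPos h < I.itemPos g)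

end LineMatching

end

/-! The sum of the `k` largest of nonnegative numbers `c i` is the minimum over `θ ≥ 0` of `k * θ +
∑ max (c i - θ) 0` (`topSum_le`, `exists_topSum_eq`). Bounds on sums of excesses that hold for every
`θ` therefore settle all `k` at once.

Upper bound. Orient the line so that `gl` is left of `gr`, and let `O` be an optimal matching that
preserves the order on the line. Give each agent a proxy: its favorite item, moved right to the
leftmost agent if it lies left of it. The order `π_a` and the order on the line sort the proxies
alike. If `p` items lie left of `G_in`, the agent at place `i` receives an item whose `O`-owner `b`
has the proxy of place `i + p`; going through that proxy costs its distance plus at most `2 *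
d(b,g)`. By maximality of `G_in`, an item outside it is at least as far from every agent as the
opposite extreme item (`Consistent.d_le_of_left`), so going through one's own proxy adds at most `2
* d(b,g)` there. What remains is the harm done by the shift from place `i` to `i + p`. Within a
residue class modulo `p` it telescopes, and each class is charged to one of the `p` agents that `O`
sends to the far items left of `G_in` (`sum_excess_shift_le`). Then `centrumCost_le_three_mul` gives
the factor 3. If `gl = gr`, the triangle inequality suffices.

Lower bound. When all agents rank alike, any one of them may be the agent that has to receive a
certain item for the cost to be near 1 instead of 3. A matching gives the item to only one agent, a
distribution gives it to some agent with probability at most `1 / n`. -/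

open scoped ENNReal

noncomputable section

namespace LineMatching

/-! ### Sums of the `k` largest values -/

/-- The sum of the `k` largest values of `c`. -/
def topSum {n : ℕ} (k : ℕ) (c : Fin n → ℝ) : ℝ :=
  ((((Finset.univ : Finset (Fin n)).val.map c).sort (· ≥ ·)).take k).sum

theorem centrumCost_eq_topSum {n : ℕ} (k : ℕ) (I : LineInstance n) (M : Matching n) :
    centrumCost k I M = topSum k fun a => I.d a (M a) := rfl

/-- The excess of `z` over the threshold `θ`. -/
def excess (θ z : ℝ) : ℝ := max (z - θ) 0

theorem excess_nonneg (θ z : ℝ) : 0 ≤ excess θ z := le_max_right _ _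

theorem sub_le_excess (θ z : ℝ) : z - θ ≤ excess θ z := le_max_left _ _

theorem excess_mono (θ : ℝ) {y z : ℝ} (h : y ≤ z) : excess θ y ≤ excess θ z :=
  max_le_max (by linarith) le_rfl

theorem sum_excess_eq {n : ℕ} (θ : ℝ) (c : Fin n → ℝ) :
    ∑ i, excess θ (c i)
      = ((((Finset.univ : Finset (Fin n)).val.map c).sort (· ≥ ·)).map (excess θ)).sum := by
  rw [← Multiset.sum_coe, ← Multiset.map_coe, Multiset.sort_eq, Multiset.map_map]
  rfl

theorem list_sum_le_length_mul_add (θ : ℝ) (l : List ℝ) :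
    l.sum ≤ l.length * θ + (l.map (excess θ)).sum := by
  induction l with
  | nil => simp
  | cons a l ih =>
    have := sub_le_excess θ a
    simp only [List.sum_cons, List.length_cons, List.map_cons]
    push_cast
    linarith

theorem list_sum_excess_nonneg (θ : ℝ) (l : List ℝ) : 0 ≤ (l.map (excess θ)).sum := by
  apply List.sum_nonneg
  intro x hx
  obtain ⟨y, -, rfl⟩ := List.mem_map.1 hx
  exact excess_nonneg _ _

/-- Each value is at most `θ` plus its excess, and the excesses left out are nonnegative. The sign
of `θ` matters because fewer than `k` values may be available. -/
theorem topSum_le {n : ℕ} (k : ℕ) (c : Fin n → ℝ) {θ : ℝ} (hθ : 0 ≤ θ) :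
    topSum k c ≤ k * θ + ∑ i, excess θ (c i) := by
  rw [sum_excess_eq, topSum]
  generalize ((Finset.univ : Finset (Fin n)).val.map c).sort (· ≥ ·) = l
  have h1 := list_sum_le_length_mul_add θ (l.take k)
  have h2 : ((l.take k).length : ℝ) ≤ k := by
    exact_mod_cast List.length_take_le k l
  have h3 : (l.map (excess θ)).sum
      = ((l.take k).map (excess θ)).sum + ((l.drop k).map (excess θ)).sum := by
    rw [← List.sum_append, ← List.map_append, List.take_append_drop]
  have h4 := list_sum_excess_nonneg θ (l.drop k)
  nlinarith [mul_le_mul_of_nonneg_right h2 hθ]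

/-- The sum of the `k` largest values is attained at the threshold given by the `k`-th one. -/
theorem exists_topSum_eq {n k : ℕ} (hk : 1 ≤ k) (hkn : k ≤ n) (c : Fin n → ℝ)
    (hc : ∀ i, 0 ≤ c i) :
    ∃ θ : ℝ, 0 ≤ θ ∧ topSum k c = k * θ + ∑ i, excess θ (c i) := by
  simp only [sum_excess_eq, topSum]
  have hlen : (((Finset.univ : Finset (Fin n)).val.map c).sort (· ≥ ·)).length = n := by simp
  have hsort := Multiset.pairwise_sort ((Finset.univ : Finset (Fin n)).val.map c) (· ≥ ·)
  have hmem : ∀ x ∈ ((Finset.univ : Finset (Fin n)).val.map c).sort (· ≥ ·), 0 ≤ x := by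
    intro x hx
    rw [Multiset.mem_sort, Multiset.mem_map] at hx
    obtain ⟨i, -, rfl⟩ := hx
    exact hc i
  generalize ((Finset.univ : Finset (Fin n)).val.map c).sort (· ≥ ·) = l at *
  have hkl : k - 1 < l.length := by omega
  -- At the `k`-th largest value, the first `k` entries equal `θ` plus their excess and all later
  -- excesses vanish.
  refine ⟨l[k - 1], hmem _ (List.getElem_mem hkl), ?_⟩
  set θ := l[k - 1] with hθ
  have h3 : (l.map (excess θ)).sum
      = ((l.take k).map (excess θ)).sum + ((l.drop k).map (excess θ)).sum := by
    rw [← List.sum_append, ← List.map_append, List.take_append_drop]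
  have hdrop : ((l.drop k).map (excess θ)).sum = 0 := by
    apply List.sum_eq_zero
    intro x hx
    obtain ⟨y, hy, rfl⟩ := List.mem_map.1 hx
    obtain ⟨j, hj, rfl⟩ := List.getElem_of_mem hy
    rw [List.getElem_drop]
    rw [List.length_drop] at hj
    have := List.pairwise_iff_getElem.1 hsort (k - 1) (k + j) hkl (by omega) (by omega)
    exact max_eq_right (by linarith)
  have htake : ∀ m : List ℝ, (∀ x ∈ m, θ ≤ x) → m.sum = m.length * θ + (m.map (excess θ)).sum := by
    intro m
    induction m with
    | nil => simp
    | cons a m ih =>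
      intro h
      have h1 : excess θ a = a - θ := max_eq_left (by linarith [h a (by simp)])
      have h2 := ih fun x hx => h x (by simp [hx])
      simp only [List.sum_cons, List.length_cons, List.map_cons, h1]
      push_cast
      linarith
  rw [h3, hdrop, htake (l.take k), List.length_take, min_eq_left (by omega), add_zero]
  intro x hx
  obtain ⟨j, hj, rfl⟩ := List.getElem_of_mem hx
  rw [List.getElem_take]
  rw [List.length_take] at hj
  rcases (by omega : j = k - 1 ∨ j < k - 1) with h | h
  · subst h; exact le_rfl
  · exact List.pairwise_iff_getElem.1 hsort j (k - 1) (by omega) hkl h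

theorem sum_le_topSum {n k : ℕ} (hk : 1 ≤ k) (hkn : k ≤ n) (c : Fin n → ℝ)
    (hc : ∀ i, 0 ≤ c i) (s : Finset (Fin n)) (hs : s.card ≤ k) : ∑ i ∈ s, c i ≤ topSum k c := by
  obtain ⟨θ, hθ, h⟩ := exists_topSum_eq hk hkn c hc
  have h1 : ∑ i ∈ s, c i ≤ ∑ i ∈ s, (θ + excess θ (c i)) :=
    Finset.sum_le_sum fun i _ => by linarith [sub_le_excess θ (c i)]
  rw [Finset.sum_add_distrib, Finset.sum_const, nsmul_eq_mul] at h1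
  have h2 : ∑ i ∈ s, excess θ (c i) ≤ ∑ i, excess θ (c i) :=
    Finset.sum_le_sum_of_subset_of_nonneg (Finset.subset_univ _) fun _ _ _ => excess_nonneg _ _
  have h3 : (s.card : ℝ) * θ ≤ k * θ := mul_le_mul_of_nonneg_right (by exact_mod_cast hs) hθ
  linarith

/-! ### Optimal matchings that preserve the order on the line -/

theorem LineInstance.d_nonneg {n : ℕ} (I : LineInstance n) (a : Agent n) (g : Item n) :
    0 ≤ I.d a g := abs_nonneg _

/-- Uncrossing increases neither the larger of the two distances nor their sum, and the excess is
convex and nondecreasing. -/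
theorem excess_uncross {θ x x' y y' : ℝ} (hx : x ≤ x') (hy : y ≤ y') :
    excess θ |x - y| + excess θ |x' - y'| ≤ excess θ |x - y'| + excess θ |x' - y| := by
  have key : ∀ {p q r s : ℝ}, p ≤ max r s → q ≤ max r s → p + q ≤ r + s →
      excess θ p + excess θ q ≤ excess θ r + excess θ s := by
    intro p q r s h1 h2 h3
    simp only [excess]
    rcases le_total r s with h | h <;> simp only [h, max_eq_left, max_eq_right] at h1 h2 <;>
    rcases max_cases (p - θ) 0 with ⟨e1, _⟩ | ⟨e1, _⟩ <;>
    rcases max_cases (q - θ) 0 with ⟨e2, _⟩ | ⟨e2, _⟩ <;>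
    rcases max_cases (r - θ) 0 with ⟨e3, _⟩ | ⟨e3, _⟩ <;>
    rcases max_cases (s - θ) 0 with ⟨e4, _⟩ | ⟨e4, _⟩ <;>
    rw [e1, e2, e3, e4] <;> linarith
  apply key
  · rcases abs_cases (x - y) with ⟨e1, _⟩ | ⟨e1, _⟩ <;> rw [e1]
    · exact le_max_of_le_right (by linarith [le_abs_self (x' - y)])
    · exact le_max_of_le_left (by linarith [neg_abs_le (x - y')])
  · rcases abs_cases (x' - y') with ⟨e1, _⟩ | ⟨e1, _⟩ <;> rw [e1]
    · exact le_max_of_le_right (by linarith [le_abs_self (x' - y)])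
    · exact le_max_of_le_left (by linarith [neg_abs_le (x - y')])
  · rcases abs_cases (x - y) with ⟨e1, _⟩ | ⟨e1, _⟩ <;>
    rcases abs_cases (x' - y') with ⟨e2, _⟩ | ⟨e2, _⟩ <;>
    rcases abs_cases (x - y') with ⟨e3, _⟩ | ⟨e3, _⟩ <;>
    rcases abs_cases (x' - y) with ⟨e4, _⟩ | ⟨e4, _⟩ <;>
    rw [e1, e2, e3, e4] <;> linarith

theorem sum_eq_add_add_erase {n : ℕ} (f : Fin n → ℝ) {a b : Fin n} (hab : a ≠ b) :
    ∑ i, f i = f a + f b + ∑ i ∈ (Finset.univ.erase a).erase b, f i := by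
  rw [← Finset.add_sum_erase _ f (Finset.mem_univ a),
    ← Finset.add_sum_erase _ f (Finset.mem_erase.2 ⟨hab.symm, Finset.mem_univ b⟩), add_assoc]

theorem topSum_mono_of_excess {n k : ℕ} (hk : 1 ≤ k) (hkn : k ≤ n) (c c' : Fin n → ℝ)
    (hc : ∀ i, 0 ≤ c i)
    (h : ∀ θ, 0 ≤ θ → ∑ i, excess θ (c' i) ≤ ∑ i, excess θ (c i)) : topSum k c' ≤ topSum k c := by
  obtain ⟨θ, hθ, e⟩ := exists_topSum_eq hk hkn c hc
  linarith [topSum_le k c' hθ, h θ hθ]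

/-- Some optimal matching preserves the order on the line. -/
theorem exists_monotone_optimal {n k : ℕ} (hk : 1 ≤ k) (hkn : k ≤ n) (I : LineInstance n) :
    ∃ O : Matching n, optCost k I = centrumCost k I O ∧
      ∀ a b, I.agentPos a < I.agentPos b → I.itemPos (O a) < I.itemPos (O b) := by
  classical
  obtain ⟨O₀, -, hO₀⟩ := Finset.exists_mem_eq_inf' (⟨Equiv.refl (Fin n), Finset.mem_univ _⟩ :
    (Finset.univ : Finset (Matching n)).Nonempty) (centrumCost k I)
  -- Tie-breaking potential: uncrossing a pair keeps a matching optimal but strictly increases `Φ`,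
  -- so an optimal matching that maximizes `Φ` has no crossed pair.
  let Φ : Matching n → ℝ := fun M => ∑ a, I.agentPos a * I.itemPos (M a)
  obtain ⟨O, hO, hmax⟩ := Finset.exists_max_image
    (Finset.univ.filter fun M : Matching n => centrumCost k I M = optCost k I) Φ
    ⟨O₀, by simp [optCost, hO₀]⟩
  rw [Finset.mem_filter] at hO
  refine ⟨O, hO.2.symm, ?_⟩
  intro a b hab
  by_contra hlt
  have hne : a ≠ b := by rintro rfl; exact lt_irrefl _ hab
  have hba : I.itemPos (O b) < I.itemPos (O a) :=
    lt_of_le_of_ne (not_lt.1 hlt) fun h => hne (O.injective (I.item_injective h)).symm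
  let N : Matching n := (Equiv.swap a b).trans O
  have hNa : N a = O b := by simp [N]
  have hNb : N b = O a := by simp [N]
  have hN : ∀ i ∈ (Finset.univ.erase a).erase b, N i = O i := by
    intro i hi
    simp only [Finset.mem_erase] at hi
    simp [N, Equiv.swap_apply_of_ne_of_ne hi.2.1 hi.1]
  have hcost : centrumCost k I N ≤ centrumCost k I O := by
    simp only [centrumCost_eq_topSum]
    refine topSum_mono_of_excess hk hkn _ _ (fun _ => I.d_nonneg _ _) fun θ _ => ?_
    rw [sum_eq_add_add_erase _ hne, sum_eq_add_add_erase (fun i => excess θ (I.d i (O i))) hne,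
      hNa, hNb, Finset.sum_congr rfl fun i hi => by rw [hN i hi]]
    have := excess_uncross (θ := θ) hab.le hba.le
    simp only [LineInstance.d]
    linarith
  have hopt : optCost k I ≤ centrumCost k I N := Finset.inf'_le _ (Finset.mem_univ N)
  have hle := hmax N (by simp; linarith [hO.2])
  simp only [Φ] at hle
  rw [sum_eq_add_add_erase _ hne,
    sum_eq_add_add_erase (fun i => I.agentPos i * I.itemPos (O i)) hne,
    hNa, hNb, Finset.sum_congr rfl fun i hi => by rw [hN i hi]] at hle
  nlinarith [mul_pos (sub_pos.2 hab) (sub_pos.2 hba)]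

/-! ### Shifted sorted sequences -/

/-- Within a residue class modulo `p`, a shift by `p` places is a step to the next index. -/
theorem sum_range_mul_eq (p N : ℕ) (f : ℕ → ℝ) :
    ∑ i ∈ Finset.range (p * N), f i
      = ∑ r ∈ Finset.range p, ∑ j ∈ Finset.range N, f (p * j + r) := by
  rw [Finset.sum_comm]
  induction N with
  | zero => simp
  | succ N ih => rw [Nat.mul_succ, Finset.sum_range_add, ih, Finset.sum_range_succ]

/-- Increments bounded by those of a monotone sequence `v` and by the excess of `v` over `t`. -/
theorem sum_increments_le {v Δ : ℕ → ℝ} (hv : Monotone v) {t : ℝ}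
    (h : ∀ j, Δ j ≤ 0 ∨ (Δ j ≤ v (j + 1) - v j ∧ Δ j ≤ v (j + 1) - t)) (N : ℕ) :
    ∑ j ∈ Finset.range N, Δ j ≤ v N - v 0 ∧ ∑ j ∈ Finset.range N, Δ j ≤ max 0 (v N - t) := by
  induction N with
  | zero => simp
  | succ N ih =>
    have h1 := hv (Nat.le_succ N)
    simp only [Nat.succ_eq_add_one] at h1
    rw [Finset.sum_range_succ]
    rcases h N with h0 | ⟨h2, h3⟩
    · refine ⟨by linarith [ih.1], ?_⟩
      have : max 0 (v N - t) ≤ max 0 (v (N + 1) - t) := max_le_max le_rfl (by linarith)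
      linarith [ih.2]
    · refine ⟨by linarith [ih.1], ?_⟩
      -- While `v N` is at most `t`, the bound of `Δ N` by `v (N + 1) - t` applies; afterwards the
      -- increments of `v` telescope.
      rcases max_cases 0 (v N - t) with ⟨e, _⟩ | ⟨e, _⟩
      · exact le_max_of_le_right (by linarith [ih.2])
      · exact le_max_of_le_right (by linarith [ih.2])

theorem excess_add_le (θ x y : ℝ) (hy : 0 ≤ y) : excess θ (x + y) ≤ excess θ x + y := by
  simp only [excess]
  exact max_le (by linarith [le_max_left (x - θ) 0]) (by linarith [le_max_right (x - θ) 0])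

/-- Agents at positions `x`, each with a proxy `W`, are sorted by their proxies in two ways, `π`
and `ρ`. Sending some of the agents `π i` to the proxy at place `i + p` instead of their own is
paid for by the costs `C` of the first `p` agents `ρ r`. -/
theorem sum_excess_shift_le {n p : ℕ} (hpn : p ≤ n) {θ : ℝ} (x W C m : Fin n → ℝ) (c R : ℝ)
    (π ρ : Equiv.Perm (Fin n)) (hπ : Monotone (W ∘ π)) (hπρ : W ∘ π = W ∘ ρ)
    (hx : ∀ a, c ≤ x a) (hW : ∀ a, c ≤ W a) (hWR : ∀ a, W a ≤ R)
    (hC : ∀ a, |x a - W a| ≤ C a)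
    (hpay : ∀ r : Fin n, (r : ℕ) < p → (x (ρ r) - c) + (R - c) ≤ C (ρ r))
    (hm : ∀ i, m i ≤ |x (π i) - W (π i)| ∨
      ∃ h : (i : ℕ) + p < n, m i ≤ |x (π i) - W (π ⟨i + p, h⟩)|) :
    ∑ i, excess θ (m i) ≤ ∑ a, excess θ (C a) := by
  -- The value `R` past the last place keeps `w` monotone, so that the classes modulo `p` can all be
  -- given the same length.
  let w : ℕ → ℝ := fun i => if h : i < n then W (π ⟨i, h⟩) else R
  have hwR : ∀ i, w i ≤ R := by
    intro i
    by_cases h : i < n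
    · simpa only [w, dif_pos h] using hWR _
    · simp only [w, dif_neg h, le_refl]
  have hw : Monotone w := by
    intro i j hij
    by_cases h : j < n
    · simp only [w, dif_pos h, dif_pos (lt_of_le_of_lt hij h)]
      exact hπ (show (⟨i, _⟩ : Fin n) ≤ ⟨j, h⟩ from hij)
    · rw [show w j = R from dif_neg h]
      exact hwR i
  let own : Fin n → ℝ := fun a => |x a - W a|
  let Δ : ℕ → ℝ := fun i =>
    if h : i < n then excess θ (m ⟨i, h⟩) - excess θ (own (π ⟨i, h⟩)) else 0
  have hΔ : ∀ i, Δ i ≤ 0 ∨ (Δ i ≤ w (i + p) - w i ∧ Δ i ≤ w (i + p) - (c + θ)) := by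
    intro i
    by_cases h : i < n
    swap
    · left; simp only [Δ, dif_neg h, le_refl]
    have hwi : w i = W (π ⟨i, h⟩) := dif_pos h
    have hΔi : Δ i = excess θ (m ⟨i, h⟩) - excess θ (own (π ⟨i, h⟩)) := dif_pos h
    rcases hm ⟨i, h⟩ with h1 | ⟨hp, h1⟩
    · left; rw [hΔi]; linarith [excess_mono θ h1]
    have hwp : w (i + p) = W (π ⟨i + p, hp⟩) := dif_pos hp
    rw [show (⟨((⟨i, h⟩ : Fin n) : ℕ) + p, hp⟩ : Fin n) = ⟨i + p, hp⟩ from rfl, ← hwp] at h1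
    have hmono := hw (Nat.le_add_right i p)
    -- A proxy that moves right without passing the agent only comes closer to it.
    by_cases hcase : w (i + p) ≤ x (π ⟨i, h⟩)
    · left
      rw [abs_of_nonneg (by linarith)] at h1
      have : m ⟨i, h⟩ ≤ own (π ⟨i, h⟩) :=
        h1.trans (le_trans (by linarith) (le_abs_self (x (π ⟨i, h⟩) - W (π ⟨i, h⟩))))
      rw [hΔi]; linarith [excess_mono θ this]
    · rw [abs_of_neg (by linarith)] at h1
      by_cases h0 : m ⟨i, h⟩ ≤ θ
      · left
        have : excess θ (m ⟨i, h⟩) = 0 := max_eq_right (by linarith)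
        rw [hΔi]; linarith [excess_nonneg θ (own (π ⟨i, h⟩))]
      · right
        rw [hΔi]
        constructor
        · have h2 : m ⟨i, h⟩ ≤ own (π ⟨i, h⟩) + (w (i + p) - w i) := by
            have := neg_abs_le (x (π ⟨i, h⟩) - W (π ⟨i, h⟩))
            simp only [own]; rw [hwi]; linarith
          have := excess_mono θ h2
          linarith [excess_add_le θ (own (π ⟨i, h⟩)) (w (i + p) - w i) (by linarith)]
        · have : excess θ (m ⟨i, h⟩) = m ⟨i, h⟩ - θ := max_eq_left (by linarith)
          linarith [excess_nonneg θ (own (π ⟨i, h⟩)), hx (π ⟨i, h⟩)]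
  have hgap : ∀ a, 0 ≤ excess θ (C a) - excess θ (own a) := fun a => by
    linarith [excess_mono θ (hC a)]
  -- The class of `r` gains at most `R - W (ρ r)` and at most `max 0 (R - c - θ)`. The agent `ρ r`
  -- can pay the first if its own distance exceeds `θ`, and the second otherwise.
  have hclass : ∀ r (hr : r < p), ∑ j ∈ Finset.range n, Δ (p * j + r)
      ≤ excess θ (C (ρ ⟨r, by omega⟩)) - excess θ (own (ρ ⟨r, by omega⟩)) := by
    intro r hr
    have hrn : r < n := by omega
    have hmv : Monotone fun j => w (p * j + r) := fun i j hij =>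
      hw (Nat.add_le_add_right (Nat.mul_le_mul_left p hij) r)
    obtain ⟨h1, h2⟩ := sum_increments_le (v := fun j => w (p * j + r))
      (Δ := fun j => Δ (p * j + r)) (t := c + θ) hmv (fun j => by
        have := hΔ (p * j + r)
        rwa [show p * j + r + p = p * (j + 1) + r by ring] at this) n
    have hwr : w (p * 0 + r) = W (ρ ⟨r, hrn⟩) := by
      rw [show p * 0 + r = r by omega]
      exact (dif_pos hrn).trans (congrFun hπρ ⟨r, hrn⟩)
    have h3 := hwR (p * n + r)
    have hp := hpay ⟨r, hrn⟩ hr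
    have hx' := hx (ρ ⟨r, hrn⟩)
    have hW' := hW (ρ ⟨r, hrn⟩)
    have hWR' := hWR (ρ ⟨r, hrn⟩)
    have h4 := sub_le_excess θ (C (ρ ⟨r, hrn⟩))
    have h5 := hgap (ρ ⟨r, hrn⟩)
    simp only [hwr] at h1
    by_cases hown : own (ρ ⟨r, hrn⟩) ≤ θ
    · have e : excess θ (own (ρ ⟨r, hrn⟩)) = 0 := max_eq_right (by linarith)
      rw [e] at h5 ⊢
      refine h2.trans (max_le h5 ?_)
      linarith
    · have e : excess θ (own (ρ ⟨r, hrn⟩)) = own (ρ ⟨r, hrn⟩) - θ := max_eq_left (by linarith)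
      rw [e]
      -- Since agent and proxy are both at least `c`, the differences `x - W` and `W - x` are at
      -- most `x + W - 2 * c`.
      have : own (ρ ⟨r, hrn⟩) ≤ C (ρ ⟨r, hrn⟩) - (R - W (ρ ⟨r, hrn⟩)) :=
        abs_le.2 ⟨by linarith, by linarith⟩
      linarith
  have hsumπ : ∑ i, excess θ (own (π i)) = ∑ a, excess θ (own a) :=
    Equiv.sum_comp π fun a => excess θ (own a)
  suffices hmain : ∑ i : Fin n, (excess θ (m i) - excess θ (own (π i)))
      ≤ ∑ a, (excess θ (C a) - excess θ (own a)) by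
    rw [Finset.sum_sub_distrib, Finset.sum_sub_distrib, hsumπ] at hmain
    linarith
  rcases Nat.eq_zero_or_pos p with hp0 | hp0
  · refine le_trans (Finset.sum_nonpos fun i _ => ?_) (Finset.sum_nonneg fun a _ => hgap a)
    have h1 : Δ i = excess θ (m i) - excess θ (own (π i)) := dif_pos i.2
    rw [← h1]
    rcases hΔ i with h | ⟨h, -⟩
    · exact h
    · simpa [hp0] using h
  have hL : ∑ i : Fin n, (excess θ (m i) - excess θ (own (π i)))
      = ∑ i ∈ Finset.range (p * n), Δ i := by
    have hsub : Finset.range n ⊆ Finset.range (p * n) :=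
      Finset.range_subset_range.2 (Nat.le_mul_of_pos_left n hp0)
    rw [← Finset.sum_subset hsub, Finset.sum_range]
    · refine Finset.sum_congr rfl fun i _ => ?_
      simp only [Δ, dif_pos i.2]
    · intro i _ hi
      exact dif_neg (by simpa using hi)
  rw [hL, sum_range_mul_eq,
    Finset.sum_range (n := p) fun r => ∑ j ∈ Finset.range n, Δ (p * j + r)]
  refine (Finset.sum_le_sum fun (r : Fin p) _ => hclass r r.2).trans ?_
  let e : Fin p ↪ Fin n := (Fin.castLEEmb hpn).trans ρ.toEmbedding
  refine le_trans (le_of_eq ?_) (Finset.sum_le_sum_of_subset_of_nonneg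
    (Finset.subset_univ (Finset.univ.map e)) fun a _ _ => hgap a)
  rw [Finset.sum_map]
  rfl

section Structure

/-! ### Preferences and favorite items -/

variable {n : ℕ} {P : Profile n}

theorem Prefers.trans {a : Agent n} {g h i : Item n} (h1 : Prefers P a g h)
    (h2 : Prefers P a h i) : Prefers P a g i := lt_trans h1 h2

theorem Prefers.asymm {a : Agent n} {g h : Item n} (h1 : Prefers P a g h) :
    ¬ Prefers P a h g := lt_asymm h1

theorem Prefers.ne {a : Agent n} {g h : Item n} (h1 : Prefers P a g h) : g ≠ h := by
  rintro rfl
  exact lt_irrefl _ h1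

theorem prefers_of_not {a : Agent n} {g h : Item n} (hne : g ≠ h) (h1 : ¬ Prefers P a g h) :
    Prefers P a h g :=
  lt_of_le_of_ne (not_lt.1 h1) fun e => hne ((P a).injective e).symm

theorem IsTop.not_prefers {a : Agent n} {t g : Item n} (h : IsTop P a t) : ¬ Prefers P a g t := by
  intro hg
  exact (h g hg.ne).asymm hg

theorem IsTop.unique {a : Agent n} {t u : Item n} (ht : IsTop P a t) (hu : IsTop P a u) :
    t = u := by
  by_contra hne
  exact ht.not_prefers (hu t hne)

/-- The favorite item of an agent. -/
def favorite (P : Profile n) (a : Agent n) : Item n := (P a).symm ⟨0, a.pos⟩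

theorem isTop_favorite (P : Profile n) (a : Agent n) : IsTop P a (favorite P a) := by
  intro h hne
  have h0 : P a (favorite P a) = ⟨0, a.pos⟩ := (P a).apply_symm_apply _
  have h1 : P a h ≠ ⟨0, a.pos⟩ := fun e => hne ((P a).injective (e.trans h0.symm))
  unfold Prefers
  rw [h0]
  exact lt_of_le_of_ne (Fin.mk_le_of_le_val (Nat.zero_le _)) h1.symm

theorem IsTop.eq_favorite {a : Agent n} {t : Item n} (h : IsTop P a t) : t = favorite P a :=
  h.unique (isTop_favorite P a)

theorem mem_Gplus {g : Item n} : g ∈ Gplus P ↔ ∃ a, IsTop P a g := by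
  classical
  simp only [Gplus, plu, Finset.mem_filter, Finset.mem_univ, true_and, Nat.one_le_iff_ne_zero,
    Finset.card_ne_zero]
  constructor
  · rintro ⟨a, ha⟩
    exact ⟨a, (Finset.mem_filter.1 ha).2⟩
  · rintro ⟨a, ha⟩
    exact ⟨a, Finset.mem_filter.2 ⟨Finset.mem_univ _, ha⟩⟩

theorem favorite_mem_Gplus (P : Profile n) (a : Agent n) : favorite P a ∈ Gplus P :=
  mem_Gplus.2 ⟨a, isTop_favorite P a⟩

theorem mem_Gin {gl gr g : Item n} {ai aj : Agent n} :
    g ∈ Gin P gl gr ai aj ↔ Prefers P ai g gr ∨ Prefers P aj g gl := by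
  classical
  simp [Gin]

theorem Gin_comm (gl gr : Item n) (ai aj : Agent n) :
    Gin P gl gr ai aj = Gin P gr gl aj ai := by
  ext g
  rw [mem_Gin, mem_Gin, or_comm]

/-! ### Single-peaked orders -/

/-- No agent ranks the middle one of three items last, with respect to the order given by the
places `ax`. -/
def SinglePeaked {α : Type*} [LinearOrder α] (P : Profile n) (ax : Item n → α) : Prop :=
  ∀ (a : Agent n) (x y z : Item n), ax x < ax y → ax y < ax z → Prefers P a y x ∨ Prefers P a y z

section SinglePeaked

variable {α β : Type*} [LinearOrder α] [LinearOrder β] {ax : Item n → α} {bx : Item n → β}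

theorem SinglePeaked.right_of_top (h : SinglePeaked P ax) (hinj : Function.Injective ax)
    {a : Agent n} {t u v : Item n} (ht : IsTop P a t) (htu : ax t ≤ ax u) (huv : ax u < ax v) :
    Prefers P a u v := by
  rcases htu.eq_or_lt with e | htu
  · rw [← hinj e] at huv ⊢
    exact ht v fun e => by rw [e] at huv; exact lt_irrefl _ huv
  · exact (h a t u v htu huv).resolve_left ht.not_prefers

theorem SinglePeaked.left_of_top (h : SinglePeaked P ax) (hinj : Function.Injective ax)
    {a : Agent n} {t u v : Item n} (ht : IsTop P a t) (hut : ax u ≤ ax t) (hvu : ax v < ax u) :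
    Prefers P a u v := by
  rcases hut.eq_or_lt with e | hut
  · rw [hinj e] at hvu ⊢
    exact ht v fun e => by rw [e] at hvu; exact lt_irrefl _ hvu
  · exact (h a v u t hvu hut).resolve_right ht.not_prefers

variable {gl gr : Item n} {al ar : Agent n}

/-- The ranking of `ar` alone tells on which side of `gl` an item of `Gin` lies. The ambiguous
items, right of `gr` but ranked below `gl` by `ar`, are not in `Gin`, as `al` ranks them below `gr`.
-/
theorem SinglePeaked.lt_left_iff (h : SinglePeaked P ax) (hinj : Function.Injective ax)
    (hl : IsTop P al gl) (hr : IsTop P ar gr) (hlr : ax gl < ax gr) {x : Item n}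
    (hx : x ∈ Gin P gl gr al ar) : ax x < ax gl ↔ Prefers P ar gl x := by
  constructor
  · intro hlt
    exact h.left_of_top hinj hr hlr.le hlt
  · intro hp
    by_contra hge
    have hlx : ax gl < ax x := lt_of_le_of_ne (not_lt.1 hge) fun e => hp.ne (hinj e)
    rcases le_or_gt (ax x) (ax gr) with hxr | hxr
    · exact hp.asymm (h.left_of_top hinj hr hxr hlx)
    · exact (mem_Gin.1 hx).elim (fun h' => h'.asymm (h.right_of_top hinj hl hlr.le hxr))
        fun h' => hp.asymm h'

theorem SinglePeaked.right_lt_iff (h : SinglePeaked P ax) (hinj : Function.Injective ax)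
    (hl : IsTop P al gl) (hr : IsTop P ar gr) (hlr : ax gl < ax gr) {x : Item n}
    (hx : x ∈ Gin P gl gr al ar) : ax gr < ax x ↔ Prefers P al gr x := by
  constructor
  · intro hlt
    exact h.right_of_top hinj hl hlr.le hlt
  · intro hp
    by_contra hge
    have hxr : ax x < ax gr := lt_of_le_of_ne (not_lt.1 hge) fun e => hp.ne (hinj e).symm
    rcases le_or_gt (ax gl) (ax x) with hlx | hlx
    · exact hp.asymm (h.right_of_top hinj hl hlx hxr)
    · exact (mem_Gin.1 hx).elim (fun h' => hp.asymm h')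
        fun h' => h'.asymm (h.left_of_top hinj hr hlr.le hlx)

/-- Two single-peaked orders agree on `Gin` if they agree on the extreme items. -/
theorem SinglePeaked.lt_of_lt (h : SinglePeaked P ax) (hinj : Function.Injective ax)
    (h' : SinglePeaked P bx) (hinj' : Function.Injective bx)
    (hl : IsTop P al gl) (hr : IsTop P ar gr) (hlr : ax gl < ax gr) (hlr' : bx gl < bx gr)
    {x y : Item n} (hx : x ∈ Gin P gl gr al ar) (hy : y ∈ Gin P gl gr al ar)
    (hxy : ax x < ax y) : bx x < bx y := by
  have xl := (h.lt_left_iff hinj hl hr hlr hx).trans (h'.lt_left_iff hinj' hl hr hlr' hx).symm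
  have yl := (h.lt_left_iff hinj hl hr hlr hy).trans (h'.lt_left_iff hinj' hl hr hlr' hy).symm
  have xr := (h.right_lt_iff hinj hl hr hlr hx).trans (h'.right_lt_iff hinj' hl hr hlr' hx).symm
  have yr := (h.right_lt_iff hinj hl hr hlr hy).trans (h'.right_lt_iff hinj' hl hr hlr' hy).symm
  by_contra hnot
  have hyx : bx y < bx x := lt_of_le_of_ne (not_lt.1 hnot) fun e => by
    rw [hinj' e] at hxy; exact lt_irrefl _ hxy
  -- Both orders have the same items of `Gin` left of `gl`, between, and right of `gr`. The ranking
  -- of `al` orders the first two zones, that of `ar` the third.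
  rcases lt_or_ge (ax y) (ax gl) with c1 | c1
  · exact (h.left_of_top hinj hl c1.le hxy).asymm
      (h'.left_of_top hinj' hl (xl.1 (hxy.trans c1)).le hyx)
  have c1' : bx gl ≤ bx y := not_lt.1 fun c => not_lt.2 c1 (yl.2 c)
  rcases lt_or_ge (ax x) (ax gl) with c2 | c2
  · exact lt_irrefl _ ((hyx.trans (xl.1 c2)).trans_le c1')
  have c2' : bx gl ≤ bx x := not_lt.1 fun c => not_lt.2 c2 (xl.2 c)
  rcases lt_or_ge (ax gr) (ax x) with c3 | c3
  · exact (h.right_of_top hinj hr c3.le hxy).asymm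
      (h'.right_of_top hinj' hr (yr.1 (c3.trans hxy)).le hyx)
  have c3' : bx x ≤ bx gr := not_lt.1 fun c => not_lt.2 c3 (xr.2 c)
  exact (h.right_of_top hinj hl c2 hxy).asymm (h'.right_of_top hinj' hl c1' hyx)

end SinglePeaked

/-! ### Consistent line instances -/

variable {I : LineInstance n}

/-- An agent is strictly closer to the middle item than to one of the outer two, so ties in distance
do no harm. -/
theorem Consistent.singlePeaked (hI : Consistent I P) : SinglePeaked P I.itemPos := by
  intro a x y z hxy hyz
  by_contra hcon
  rw [not_or] at hcon
  have h1 := hI a x y (prefers_of_not (by rintro rfl; exact lt_irrefl _ hxy) hcon.1)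
  have h2 := hI a z y (prefers_of_not (by rintro rfl; exact lt_irrefl _ hyz) hcon.2)
  unfold LineInstance.d at h1 h2
  rcases abs_cases (I.agentPos a - I.itemPos y) with ⟨e, _⟩ | ⟨e, _⟩
  · linarith [le_abs_self (I.agentPos a - I.itemPos x)]
  · linarith [neg_abs_le (I.agentPos a - I.itemPos z)]

theorem Consistent.d_top_le (hI : Consistent I P) {a : Agent n} {t : Item n} (ht : IsTop P a t)
    (g : Item n) : I.d a t ≤ I.d a g := by
  rcases eq_or_ne g t with rfl | hne
  · exact le_rfl
  · exact hI a t g (ht g hne)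

theorem LineInstance.midpoint_le_of_d_le {a : Agent n} {g h : Item n}
    (hgh : I.itemPos g < I.itemPos h) (hd : I.d a h ≤ I.d a g) :
    I.itemPos g + I.itemPos h ≤ 2 * I.agentPos a := by
  unfold LineInstance.d at hd
  by_contra hlt
  rcases abs_cases (I.agentPos a - I.itemPos g) with ⟨e, _⟩ | ⟨e, _⟩ <;>
    linarith [neg_abs_le (I.agentPos a - I.itemPos h)]

theorem LineInstance.le_midpoint_of_d_le {a : Agent n} {g h : Item n}
    (hgh : I.itemPos g < I.itemPos h) (hd : I.d a g ≤ I.d a h) :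
    2 * I.agentPos a ≤ I.itemPos g + I.itemPos h := by
  unfold LineInstance.d at hd
  by_contra hlt
  rcases abs_cases (I.agentPos a - I.itemPos h) with ⟨e, _⟩ | ⟨e, _⟩ <;>
    linarith [le_abs_self (I.agentPos a - I.itemPos g)]

/-- Agents further to the right have favorite items further to the right. -/
theorem Consistent.itemPos_favorite_le (hI : Consistent I P) {a b : Agent n}
    (hab : I.agentPos a ≤ I.agentPos b) :
    I.itemPos (favorite P a) ≤ I.itemPos (favorite P b) := by
  by_contra hlt
  push Not at hlt
  have h1 := I.midpoint_le_of_d_le hlt (hI.d_top_le (isTop_favorite P a) _)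
  have h2 := I.le_midpoint_of_d_le hlt (hI.d_top_le (isTop_favorite P b) _)
  have : a = b := I.agent_injective (by linarith)
  rw [this] at hlt
  exact lt_irrefl _ hlt

/-- The reflected instance. -/
def LineInstance.reflect (I : LineInstance n) : LineInstance n where
  agentPos a := -I.agentPos a
  itemPos g := -I.itemPos g
  agent_injective _ _ h := I.agent_injective (neg_injective h)
  item_injective _ _ h := I.item_injective (neg_injective h)
  agent_ne_item a g h := I.agent_ne_item a g (neg_injective h)

theorem LineInstance.reflect_d (I : LineInstance n) : I.reflect.d = I.d := by
  funext a g
  simp only [LineInstance.d, LineInstance.reflect]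
  rw [← abs_neg]
  congr 1
  ring

theorem Consistent.reflect (hI : Consistent I P) : Consistent I.reflect P := by
  intro a g h hp
  rw [I.reflect_d]
  exact hI a g h hp

theorem LineInstance.reflect_centrumCost (I : LineInstance n) (k : ℕ) :
    centrumCost k I.reflect = centrumCost k I := by
  funext M
  simp only [centrumCost, I.reflect_d]

theorem LineInstance.reflect_optCost (I : LineInstance n) (k : ℕ) :
    optCost k I.reflect = optCost k I := by
  simp only [optCost, I.reflect_centrumCost]

/-- The items that are ranked last in `Gplus` by some agent are its leftmost and its rightmost
item. -/
theorem Consistent.lastInGplus_iff (hI : Consistent I P) {lo hi : Item n} (hlo : lo ∈ Gplus P)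
    (hhi : hi ∈ Gplus P) (hmin : ∀ h ∈ Gplus P, I.itemPos lo ≤ I.itemPos h)
    (hmax : ∀ h ∈ Gplus P, I.itemPos h ≤ I.itemPos hi) (g : Item n) :
    LastInGplus P g ↔ g = lo ∨ g = hi := by
  constructor
  · rintro ⟨hg, a, ha⟩
    by_contra hcon
    rw [not_or] at hcon
    have h1 := lt_of_le_of_ne (hmin g hg) fun e => hcon.1 (I.item_injective e).symm
    have h2 := lt_of_le_of_ne (hmax g hg) fun e => hcon.2 (I.item_injective e)
    rcases hI.singlePeaked a lo g hi h1 h2 with h | h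
    · exact h.asymm (ha lo hlo (Ne.symm hcon.1))
    · exact h.asymm (ha hi hhi (Ne.symm hcon.2))
  · rintro (rfl | rfl)
    · obtain ⟨a, ha⟩ := mem_Gplus.1 hhi
      refine ⟨hlo, a, fun h hh hne => ?_⟩
      exact hI.singlePeaked.left_of_top I.item_injective ha (hmax h hh)
        (lt_of_le_of_ne (hmin h hh) fun e => hne (I.item_injective e).symm)
    · obtain ⟨a, ha⟩ := mem_Gplus.1 hlo
      refine ⟨hhi, a, fun h hh hne => ?_⟩
      exact hI.singlePeaked.right_of_top I.item_injective ha (hmin h hh)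
        (lt_of_le_of_ne (hmax h hh) fun e => hne (I.item_injective e))

theorem exists_extremes (hn : 1 ≤ n) (P : Profile n) (I : LineInstance n) :
    ∃ lo ∈ Gplus P, ∃ hi ∈ Gplus P, (∀ h ∈ Gplus P, I.itemPos lo ≤ I.itemPos h) ∧
      ∀ h ∈ Gplus P, I.itemPos h ≤ I.itemPos hi := by
  have hne : (Gplus P).Nonempty := ⟨_, favorite_mem_Gplus P ⟨0, hn⟩⟩
  obtain ⟨lo, hlo, h1⟩ := Finset.exists_min_image _ I.itemPos hne
  obtain ⟨hi, hhi, h2⟩ := Finset.exists_max_image _ I.itemPos hne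
  exact ⟨lo, hlo, hi, hhi, h1, h2⟩

theorem OrderMatchRun.itemPos_favorite_mem (hI : Consistent I P) (R : OrderMatchRun P)
    (hlr : I.itemPos R.gl ≤ I.itemPos R.gr) (a : Agent n) :
    I.itemPos R.gl ≤ I.itemPos (favorite P a) ∧ I.itemPos (favorite P a) ≤ I.itemPos R.gr := by
  obtain ⟨lo, hlo, hi, hhi, h1, h2⟩ := exists_extremes a.pos P I
  have hext := hI.lastInGplus_iff hlo hhi h1 h2
  have ha := favorite_mem_Gplus P a
  constructor
  · rcases (R.extreme lo).1 ((hext lo).2 (Or.inl rfl)) with e | e <;> rw [e] at h1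
    · exact h1 _ ha
    · exact hlr.trans (h1 _ ha)
  · rcases (R.extreme hi).1 ((hext hi).2 (Or.inr rfl)) with e | e <;> rw [e] at h2
    · exact (h2 _ ha).trans hlr
    · exact h2 _ ha

/-! ### Items outside `G_in` and the maximality of its size -/

section Outside

variable {gl gr : Item n} {al ar : Agent n}

theorem Consistent.mem_Gin_of_between (hI : Consistent I P) (hl : IsTop P al gl)
    (hr : IsTop P ar gr) (hlr : I.itemPos gl < I.itemPos gr) {x : Item n}
    (h1 : I.itemPos gl ≤ I.itemPos x) (h2 : I.itemPos x ≤ I.itemPos gr) :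
    x ∈ Gin P gl gr al ar := by
  rw [mem_Gin]
  rcases h2.eq_or_lt with e | h2
  · right
    rw [I.item_injective e]
    exact hr gl fun e => by rw [e] at hlr; exact lt_irrefl _ hlr
  · exact Or.inl (hI.singlePeaked.right_of_top I.item_injective hl h1 h2)

/-- By the choice of `al`, no agent is closer to an item to the left of `Gin` than to `gr`. -/
theorem Consistent.d_le_of_left (hI : Consistent I P) (hl : IsTop P al gl)
    (hr : IsTop P ar gr) (hlr : I.itemPos gl < I.itemPos gr)
    (hfav : ∀ a, I.itemPos gl ≤ I.itemPos (favorite P a))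
    (hmax : ∀ ai, IsTop P ai gl → (Gin P gl gr ai ar).card ≤ (Gin P gl gr al ar).card)
    {x : Item n} (hx : x ∉ Gin P gl gr al ar) (hxl : I.itemPos x < I.itemPos gl) (a : Agent n) :
    I.d a gr ≤ I.d a x := by
  have hsp := hI.singlePeaked
  have hinj := I.item_injective
  have hne : ∀ {g h : Item n}, I.itemPos g < I.itemPos h → g ≠ h := by
    rintro g h hgh rfl; exact lt_irrefl _ hgh
  have htop : ∀ ai, IsTop P ai gl → I.d ai gr ≤ I.d ai x := by
    intro ai hai
    refine hI ai gr x (prefers_of_not (hne (hxl.trans hlr)) fun hp => ?_)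
    have hal : ¬ Prefers P al x gr := fun h => hx (mem_Gin.2 (Or.inl h))
    -- If `ai` preferred `x` to `gr`, replacing `al` by `ai` would keep all of `Gin` and add `x`.
    -- Nothing is lost: items that `al` prefers to `gr` lie right of `x`, as otherwise `al` would
    -- prefer `x` to `gr` too.
    refine absurd (hmax ai hai) (not_le.2 (Finset.card_lt_card ?_))
    refine Finset.ssubset_iff_subset_ne.2 ⟨fun g hg => ?_, fun e => hx (e ▸ mem_Gin.2 (Or.inl hp))⟩
    rcases mem_Gin.1 hg with h | h
    swap
    · exact mem_Gin.2 (Or.inr h)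
    rcases lt_or_ge (I.itemPos gr) (I.itemPos g) with hg1 | hg1
    · exact absurd h (hsp.right_of_top hinj hl hlr.le hg1).asymm
    rcases le_or_gt (I.itemPos gl) (I.itemPos g) with hg2 | hg2
    · exact hI.mem_Gin_of_between hai hr hlr hg2 hg1
    rcases lt_trichotomy (I.itemPos g) (I.itemPos x) with hg3 | hg3 | hg3
    · exact absurd ((hsp.left_of_top hinj hl hxl.le hg3).trans h) hal
    · rw [hinj hg3] at h
      exact absurd h hal
    · exact mem_Gin.2 (Or.inl ((hsp.left_of_top hinj hai hg2.le hg3).trans hp))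
  rcases eq_or_ne (favorite P a) gl with e | hane
  · exact htop a (e ▸ isTop_favorite P a)
  -- An agent with another favorite is at least as far right as `al`, which is already past the
  -- midpoint of `x` and `gr`.
  · have h1 := I.midpoint_le_of_d_le (hxl.trans hlr) (htop al hl)
    have hlt := lt_of_le_of_ne (hfav a) fun e => hane (hinj e).symm
    have h2 := I.midpoint_le_of_d_le hlt (hI.d_top_le (isTop_favorite P a) _)
    have h3 := I.le_midpoint_of_d_le hlt (hI.d_top_le hl _)
    unfold LineInstance.d
    exact abs_le.2 ⟨by linarith [le_abs_self (I.agentPos a - I.itemPos x)],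
      by linarith [le_abs_self (I.agentPos a - I.itemPos x)]⟩

end Outside

theorem OrderMatchRun.d_right_le (hI : Consistent I P) (R : OrderMatchRun P)
    (hlr : I.itemPos R.gl < I.itemPos R.gr) {x : Item n} (hx : x ∉ Gin P R.gl R.gr R.al R.ar)
    (hxl : I.itemPos x < I.itemPos R.gl) (a : Agent n) : I.d a R.gr ≤ I.d a x :=
  hI.d_le_of_left R.top_al R.top_ar hlr (fun a => (R.itemPos_favorite_mem hI hlr.le a).1)
    (fun ai hai => R.maximal ai R.ar hai R.top_ar) hx hxl a

theorem OrderMatchRun.d_left_le (hI : Consistent I P) (R : OrderMatchRun P)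
    (hlr : I.itemPos R.gl < I.itemPos R.gr) {x : Item n} (hx : x ∉ Gin P R.gl R.gr R.al R.ar)
    (hxr : I.itemPos R.gr < I.itemPos x) (a : Agent n) : I.d a R.gl ≤ I.d a x := by
  rw [← I.reflect_d]
  rw [Gin_comm] at hx
  refine hI.reflect.d_le_of_left R.top_ar R.top_al (neg_lt_neg hlr)
    (fun a => neg_le_neg (R.itemPos_favorite_mem hI hlr.le a).2) (fun aj haj => ?_) hx
    (neg_lt_neg hxr) a
  rw [Gin_comm, Gin_comm R.gr]
  exact R.maximal R.al aj R.top_al haj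

theorem OrderMatchRun.outside (hI : Consistent I P) (R : OrderMatchRun P)
    (hlr : I.itemPos R.gl < I.itemPos R.gr) {x : Item n} (hx : x ∉ Gin P R.gl R.gr R.al R.ar) :
    I.itemPos x < I.itemPos R.gl ∨ I.itemPos R.gr < I.itemPos x := by
  by_contra hcon
  rw [not_or, not_lt, not_lt] at hcon
  exact hx (hI.mem_Gin_of_between R.top_al R.top_ar hlr hcon.1 hcon.2)

theorem OrderMatchRun.pairwise_itemPos (hI : Consistent I P) (R : OrderMatchRun P)
    (hlr : I.itemPos R.gl < I.itemPos R.gr) :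
    R.itemOrder.Pairwise fun g h => I.itemPos g < I.itemPos h := by
  have hax : R.axis R.gl < R.axis R.gr := lt_of_le_of_ne R.gl_le_gr fun e => by
    rw [R.axis.injective e] at hlr; exact lt_irrefl _ hlr
  have hsp : SinglePeaked P R.axis := R.singlePeaked
  refine R.sorted_itemOrder.imp_of_mem fun {g h} hg hh hgh => ?_
  exact hsp.lt_of_lt R.axis.injective hI.singlePeaked I.item_injective R.top_al R.top_ar hax hlr
    ((R.mem_itemOrder g).1 hg) ((R.mem_itemOrder h).1 hh) hgh

theorem OrderMatchRun.isTrueOrder (hI : Consistent I P) (R : OrderMatchRun P) :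
    IsTrueOrder I R.itemOrder := by
  rcases lt_trichotomy (I.itemPos R.gl) (I.itemPos R.gr) with h | h | h
  · exact Or.inl (R.pairwise_itemPos hI h)
  -- With a single extreme item, `Gin` would consist of items preferred to a favorite, so it is
  -- empty.
  · have hnil : R.itemOrder = [] := by
      refine List.eq_nil_iff_forall_not_mem.2 fun g hg => ?_
      have hgr := R.top_ar
      rw [R.mem_itemOrder, mem_Gin, I.item_injective h] at hg
      exact hg.elim (fun h' => (I.item_injective h ▸ R.top_al).not_prefers h') hgr.not_prefers
    rw [hnil]
    exact Or.inl List.Pairwise.nil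
  · exact Or.inr ((R.pairwise_itemPos hI.reflect (neg_lt_neg h)).imp fun h => neg_lt_neg_iff.1 h)

end Structure

/-! ### Enumerations of finite types by lists -/

theorem exists_equiv_getElem {n : ℕ} (F : List (Fin n)) (hnd : F.Nodup) (hmem : ∀ g, g ∈ F) :
    ∃ (hlen : F.length = n) (e : Fin n ≃ Fin n),
      ∀ i : Fin n, e i = F[(i : ℕ)]'(hlen.symm ▸ i.2) := by
  have hlen : F.length = n := by
    rw [← List.toFinset_card_of_nodup hnd, show F.toFinset = Finset.univ from
      Finset.eq_univ_of_forall fun g => List.mem_toFinset.2 (hmem g), Finset.card_univ,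
      Fintype.card_fin]
  refine ⟨hlen, Equiv.ofBijective (fun i : Fin n => F[(i : ℕ)]'(hlen.symm ▸ i.2))
    ((Fintype.bijective_iff_injective_and_card _).2 ⟨fun i j hij => ?_, rfl⟩), fun i => rfl⟩
  exact Fin.ext ((hnd.getElem_inj_iff).1 hij)

theorem exists_sorted_list {n : ℕ} {α : Type*} [LinearOrder α] {u : Fin n → α}
    (hu : Function.Injective u) (p : Fin n → Prop) :
    ∃ l : List (Fin n), l.Pairwise (fun g h => u g < u h) ∧ ∀ g, g ∈ l ↔ p g := by
  classical
  refine ⟨(List.ofFn (Tuple.sort u)).filter fun g => decide (p g), ?_, fun g => ?_⟩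
  · refine List.Pairwise.filter _ (List.pairwise_ofFn.2 fun i j hij => ?_)
    exact lt_of_le_of_ne (Tuple.monotone_sort u hij.le) fun e =>
      hij.ne ((Tuple.sort u).injective (hu e))
  · simp only [List.mem_filter, List.mem_ofFn, decide_eq_true_eq, and_iff_right_iff_imp]
    exact fun _ => (Tuple.sort u).surjective g

/-! ### OrderMatch is well defined -/

/-- The given instance is a witness only: its left-to-right order serves as the axis, and the agents
are sorted by their favorites along it. -/
theorem Consistent.exists_orderMatchRun {n : ℕ} (hn : 1 ≤ n) {P : Profile n} {I : LineInstance n}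
    (hI : Consistent I P) : Nonempty (OrderMatchRun P) := by
  classical
  obtain ⟨gl, hgl, gr, hgr, h1, h2⟩ := exists_extremes hn P I
  obtain ⟨a₁, ha₁⟩ := mem_Gplus.1 hgl
  obtain ⟨a₂, ha₂⟩ := mem_Gplus.1 hgr
  obtain ⟨⟨al, ar⟩, hmem, hmax⟩ := Finset.exists_max_image
    (Finset.univ.filter fun q : Agent n × Agent n => IsTop P q.1 gl ∧ IsTop P q.2 gr)
    (fun q => (Gin P gl gr q.1 q.2).card) ⟨(a₁, a₂), by simp [ha₁, ha₂]⟩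
  simp only [Finset.mem_filter, Finset.mem_univ, true_and] at hmem hmax
  let axis : Item n ≃ Fin n := (Tuple.sort I.itemPos).symm
  have hle : ∀ {g h : Item n}, axis g ≤ axis h → I.itemPos g ≤ I.itemPos h := by
    intro g h hgh
    have := Tuple.monotone_sort I.itemPos hgh
    simpa [axis] using this
  have hlt : ∀ {g h : Item n}, axis g < axis h → I.itemPos g < I.itemPos h := by
    intro g h hgh
    exact lt_of_le_of_ne (hle hgh.le) fun e => by
      rw [I.item_injective e] at hgh; exact lt_irrefl _ hgh
  obtain ⟨L, hL, hLmem⟩ := exists_sorted_list axis.injective (· ∈ Gin P gl gr al ar)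
  obtain ⟨L', hL', hLmem'⟩ := exists_sorted_list axis.injective (· ∉ Gin P gl gr al ar)
  let top : Agent n → Fin n := fun a => axis (favorite P a)
  obtain ⟨hlen, e, he⟩ := exists_equiv_getElem (L ++ L')
    (List.nodup_append'.2 ⟨hL.imp fun h e => by rw [e] at h; exact lt_irrefl _ h,
      hL'.imp fun h e => by rw [e] at h; exact lt_irrefl _ h,
      fun g hg hg' => (hLmem' g).1 hg' ((hLmem g).1 hg)⟩)
    (fun g => by rw [List.mem_append, hLmem, hLmem']; exact em _)
  exact ⟨{
    gl := gl
    gr := gr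
    extreme := hI.lastInGplus_iff hgl hgr h1 h2
    al := al
    ar := ar
    top_al := hmem.1
    top_ar := hmem.2
    maximal := fun ai aj hai haj => hmax (ai, aj) ⟨hai, haj⟩
    axis := axis
    singlePeaked := fun a x y z hxy hyz => hI.singlePeaked a x y z (hlt hxy) (hlt hyz)
    gl_le_gr := not_lt.1 fun h => not_lt.2 (h1 gr hgr) (hlt h)
    itemOrder := L
    mem_itemOrder := hLmem
    sorted_itemOrder := hL
    agentOrder := Tuple.sort top
    agentOrder_spec := by
      intro a b i j hi hj hij
      by_contra hcon
      have hmono := Tuple.monotone_sort top (not_lt.1 hcon)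
      simp only [Function.comp_apply, Equiv.apply_symm_apply, top] at hmono
      rw [← hi.eq_favorite, ← hj.eq_favorite] at hmono
      exact not_lt.2 hmono (List.pairwise_iff_getElem.1 hL i j i.2 j.2 hij)
    matching := (Tuple.sort top).symm.trans e
    matching_spec := by
      intro i h
      rw [Equiv.trans_apply, Equiv.symm_apply_apply, he, List.getElem_append_left h] }⟩

theorem exists_isOrderMatch {n : ℕ} (hn : 1 ≤ n) : ∃ ALG : Algorithm n, IsOrderMatch ALG := by
  classical
  refine ⟨fun P => if h : Nonempty (OrderMatchRun P) then h.some.matching else Equiv.refl _, ?_⟩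
  rintro P ⟨I, hI⟩
  have h := hI.exists_orderMatchRun hn
  exact ⟨h.some, by simp only [dif_pos h]⟩

section UpperBound

/-! ### The distortion of OrderMatch -/

variable {n : ℕ} {P : Profile n} {I : LineInstance n}

/-- Moving a proxy right to the leftmost agent brings it no farther from any agent. -/
theorem abs_sub_max_le {x t c : ℝ} (h : c ≤ x) : |x - max t c| ≤ |x - t| := by
  rcases max_cases t c with ⟨e, _⟩ | ⟨e, _⟩
  · rw [e]
  · rw [e, abs_of_nonneg (by linarith)]
    linarith [le_abs_self (x - t)]

/-- The split `3 * θ = θ + 2 * θ` of the threshold matches the two terms of the bound on `z`. -/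
theorem excess_three_mul_le {θ z u v : ℝ} (h : z ≤ u + 2 * v) :
    excess (3 * θ) z ≤ excess θ u + 2 * excess θ v :=
  max_le (by linarith [sub_le_excess θ u, sub_le_excess θ v])
    (by linarith [excess_nonneg θ u, excess_nonneg θ v])

/-- If each distance in `M` is bounded by `m` and twice the distance of an agent in `O`, every such
agent being used once, and `m` is dominated by the distances in `O`, then `M` costs at most
three times as much as `O`. -/
theorem centrumCost_le_three_mul {k : ℕ} (hk : 1 ≤ k) (hkn : k ≤ n) (M O : Matching n)
    (π : Equiv.Perm (Fin n)) (m : Fin n → ℝ)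
    (hd : ∀ i, I.d (π i) (M (π i)) ≤ m i + 2 * I.d (O.symm (M (π i))) (M (π i)))
    (hm : ∀ θ, 0 ≤ θ → ∑ i, excess θ (m i) ≤ ∑ a, excess θ (I.d a (O a))) :
    centrumCost k I M ≤ 3 * centrumCost k I O := by
  simp only [centrumCost_eq_topSum]
  obtain ⟨θ, hθ, hO⟩ := exists_topSum_eq hk hkn (fun a => I.d a (O a)) fun _ => I.d_nonneg _ _
  have h1 := topSum_le k (fun a => I.d a (M a)) (θ := 3 * θ) (by linarith)
  have h2 : ∑ a, excess (3 * θ) (I.d a (M a))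
      ≤ ∑ i, (excess θ (m i) + 2 * excess θ (I.d (O.symm (M (π i))) (M (π i)))) := by
    rw [← Equiv.sum_comp π]
    exact Finset.sum_le_sum fun i _ => excess_three_mul_le (hd i)
  rw [Finset.sum_add_distrib, ← Finset.mul_sum] at h2
  have h3 := Equiv.sum_comp ((π.trans M).trans O.symm) fun a => excess θ (I.d a (O a))
  simp only [Equiv.trans_apply, Equiv.apply_symm_apply] at h3
  rw [h3] at h2
  have h4 := hm θ hθ
  rw [hO]
  linarith

/-- All agents share one favorite item here, and any matching will do: go to the favorite, then from
there to `g` by way of the `O`-owner of `g`. -/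
theorem OrderMatchRun.centrumCost_le_of_eq (hI : Consistent I P) (R : OrderMatchRun P)
    (hlr : R.gl = R.gr) {k : ℕ} (hk : 1 ≤ k) (hkn : k ≤ n) (O : Matching n) :
    centrumCost k I R.matching ≤ 3 * centrumCost k I O := by
  have hfav : ∀ a, IsTop P a R.gl := by
    intro a
    have h := R.itemPos_favorite_mem hI (hlr ▸ le_rfl) a
    rw [← hlr] at h
    rw [← I.item_injective (le_antisymm h.2 h.1)]
    exact isTop_favorite P a
  refine centrumCost_le_three_mul hk hkn R.matching O (Equiv.refl _) (fun a => I.d a R.gl)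
    (fun a => ?_) fun θ _ => Finset.sum_le_sum fun a _ => excess_mono θ (hI.d_top_le (hfav a) _)
  simp only [Equiv.refl_apply]
  set g := R.matching a
  have h1 := hI.d_top_le (hfav (O.symm g)) g
  have h2 : I.d a g ≤ I.d a R.gl + |I.itemPos R.gl - I.itemPos g| := abs_sub_le _ _ _
  have h3 : |I.itemPos R.gl - I.itemPos g| ≤ I.d (O.symm g) R.gl + I.d (O.symm g) g := by
    have := abs_sub_le (I.itemPos R.gl) (I.agentPos (O.symm g)) (I.itemPos g)
    rwa [abs_sub_comm (I.itemPos R.gl) (I.agentPos (O.symm g))] at this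
  linarith

theorem OrderMatchRun.lt_of_left (hI : Consistent I P) (R : OrderMatchRun P)
    (hlr : I.itemPos R.gl < I.itemPos R.gr) {x g : Item n}
    (hx : x ∉ Gin P R.gl R.gr R.al R.ar) (hxl : I.itemPos x < I.itemPos R.gl)
    (hg : g ∈ Gin P R.gl R.gr R.al R.ar) : I.itemPos x < I.itemPos g := by
  by_contra hcon
  have hgx : I.itemPos g < I.itemPos x := lt_of_le_of_ne (not_lt.1 hcon) fun e =>
    hx (I.item_injective e ▸ hg)
  rcases mem_Gin.1 hg with h | h
  · exact hx (mem_Gin.2 (Or.inl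
      ((hI.singlePeaked.left_of_top I.item_injective R.top_al hxl.le hgx).trans h)))
  · exact h.asymm (hI.singlePeaked.left_of_top I.item_injective R.top_ar hlr.le (hgx.trans hxl))

theorem OrderMatchRun.lt_of_right (hI : Consistent I P) (R : OrderMatchRun P)
    (hlr : I.itemPos R.gl < I.itemPos R.gr) {x g : Item n}
    (hx : x ∉ Gin P R.gl R.gr R.al R.ar) (hxr : I.itemPos R.gr < I.itemPos x)
    (hg : g ∈ Gin P R.gl R.gr R.al R.ar) : I.itemPos g < I.itemPos x := by
  by_contra hcon
  have hgx : I.itemPos x < I.itemPos g := lt_of_le_of_ne (not_lt.1 hcon) fun e =>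
    hx (I.item_injective e ▸ hg)
  rcases mem_Gin.1 hg with h | h
  · exact h.asymm (hI.singlePeaked.right_of_top I.item_injective R.top_al hlr.le (hxr.trans hgx))
  · exact hx (mem_Gin.2 (Or.inr
      ((hI.singlePeaked.right_of_top I.item_injective R.top_ar hxr.le hgx).trans h)))

/-- The items from left to right; those of `Gin` occupy consecutive places. -/
theorem OrderMatchRun.exists_itemEnum (hI : Consistent I P) (R : OrderMatchRun P)
    (hlr : I.itemPos R.gl < I.itemPos R.gr) :
    ∃ (p : ℕ) (hp : p + R.itemOrder.length ≤ n) (γ : Fin n ≃ Item n), StrictMono (I.itemPos ∘ γ) ∧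
      (∀ r : Fin n, (r : ℕ) < p →
        γ r ∉ Gin P R.gl R.gr R.al R.ar ∧ I.itemPos (γ r) < I.itemPos R.gl) ∧
      ∀ (i : ℕ) (h : i < R.itemOrder.length), γ ⟨i + p, by omega⟩ = R.itemOrder[i] := by
  obtain ⟨X, hX, hXmem⟩ := exists_sorted_list I.item_injective
    fun g => g ∉ Gin P R.gl R.gr R.al R.ar ∧ I.itemPos g < I.itemPos R.gl
  obtain ⟨Y, hY, hYmem⟩ := exists_sorted_list I.item_injective
    fun g => g ∉ Gin P R.gl R.gr R.al R.ar ∧ I.itemPos R.gr < I.itemPos g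
  have hsort : (X ++ R.itemOrder ++ Y).Pairwise fun g h => I.itemPos g < I.itemPos h := by
    rw [List.pairwise_append, List.pairwise_append]
    refine ⟨⟨hX, R.pairwise_itemPos hI hlr, fun x hx g hg => ?_⟩, hY, fun g hg y hy => ?_⟩
    · rw [hXmem] at hx
      exact R.lt_of_left hI hlr hx.1 hx.2 ((R.mem_itemOrder g).1 hg)
    · rw [hYmem] at hy
      rcases List.mem_append.1 hg with hg | hg
      · rw [hXmem] at hg
        exact hg.2.trans (hlr.trans hy.2)
      · exact R.lt_of_right hI hlr hy.1 hy.2 ((R.mem_itemOrder g).1 hg)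
  obtain ⟨hlen, γ, hγ⟩ := exists_equiv_getElem (X ++ R.itemOrder ++ Y)
    (hsort.imp fun h e => by rw [e] at h; exact lt_irrefl _ h) (fun g => by
      rw [List.mem_append, List.mem_append, hXmem, hYmem, R.mem_itemOrder]
      by_cases hg : g ∈ Gin P R.gl R.gr R.al R.ar
      · exact Or.inl (Or.inr hg)
      · rcases R.outside hI hlr hg with h | h
        · exact Or.inl (Or.inl ⟨hg, h⟩)
        · exact Or.inr ⟨hg, h⟩)
  have hlen' : X.length + R.itemOrder.length + Y.length = n := by
    simpa only [List.length_append] using hlen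
  refine ⟨X.length, by omega, γ, fun i j hij => ?_, fun r hr => ?_, fun i h => ?_⟩
  · simp only [Function.comp_apply, hγ]
    exact List.pairwise_iff_getElem.1 hsort i j _ _ hij
  · rw [← hXmem, hγ, List.getElem_append_left (by rw [List.length_append]; omega),
      List.getElem_append_left hr]
    exact List.getElem_mem hr
  · rw [hγ, List.getElem_append_left (by rw [List.length_append]; simp only; omega),
      List.getElem_append_right (by simp only; omega)]
    simp only [Nat.add_sub_cancel]

/-- All favorites lie between `gl` and `gr`, hence in `G_in`, where `π_g` is the order on the line.
-/
theorem OrderMatchRun.monotone_favorite_agentOrder (hI : Consistent I P) (R : OrderMatchRun P)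
    (hlr : I.itemPos R.gl < I.itemPos R.gr) :
    Monotone fun i => I.itemPos (favorite P (R.agentOrder i)) := by
  intro i j hij
  by_contra hlt
  simp only [not_le] at hlt
  have hmem : ∀ a, favorite P a ∈ R.itemOrder := fun a => by
    rw [R.mem_itemOrder]
    have := R.itemPos_favorite_mem hI hlr.le a
    exact hI.mem_Gin_of_between R.top_al R.top_ar hlr this.1 this.2
  obtain ⟨s, hs, es⟩ := List.getElem_of_mem (hmem (R.agentOrder i))
  obtain ⟨t, ht, et⟩ := List.getElem_of_mem (hmem (R.agentOrder j))
  have hts : t < s := by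
    by_contra hcon
    have hpw := List.pairwise_iff_getElem.1 (R.pairwise_itemPos hI hlr)
    rcases (not_lt.1 hcon).eq_or_lt with e | h
    · subst e
      rw [← es, ← et] at hlt
      exact lt_irrefl _ hlt
    · have := hpw s t hs ht h
      rw [es, et] at this
      exact lt_asymm this hlt
  have := R.agentOrder_spec (R.agentOrder j) (R.agentOrder i) ⟨t, ht⟩ ⟨s, hs⟩
    (by simp only [Fin.getElem_fin, et]; exact isTop_favorite P _)
    (by simp only [Fin.getElem_fin, es]; exact isTop_favorite P _) hts
  rw [Equiv.symm_apply_apply, Equiv.symm_apply_apply] at this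
  exact not_lt.2 hij this

theorem OrderMatchRun.matching_notMem (R : OrderMatchRun P)
    {i : Fin n} (hi : R.itemOrder.length ≤ (i : ℕ)) :
    R.matching (R.agentOrder i) ∉ Gin P R.gl R.gr R.al R.ar := by
  intro h
  rw [← R.mem_itemOrder] at h
  obtain ⟨s, hs, es⟩ := List.getElem_of_mem h
  have hnd : R.itemOrder.Nodup :=
    R.sorted_itemOrder.imp fun h e => by rw [e] at h; exact lt_irrefl _ h
  have hsn : s < n := lt_of_lt_of_le hs (by
    simpa using hnd.length_le_card)
  have := R.matching_spec ⟨s, hsn⟩ hs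
  rw [es] at this
  have := R.agentOrder.injective (R.matching.injective this)
  rw [← this] at hi
  simp only at hi
  omega

theorem OrderMatchRun.centrumCost_le_of_lt (hI : Consistent I P) (R : OrderMatchRun P)
    (hlr : I.itemPos R.gl < I.itemPos R.gr) {k : ℕ} (hk : 1 ≤ k) (hkn : k ≤ n) (O : Matching n)
    (hO : ∀ a b, I.agentPos a < I.agentPos b → I.itemPos (O a) < I.itemPos (O b)) :
    centrumCost k I R.matching ≤ 3 * centrumCost k I O := by
  obtain ⟨p, hp, γ, hγ, hγX, hγL⟩ := R.exists_itemEnum hI hlr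
  obtain ⟨a₀, -, ha₀⟩ := Finset.exists_min_image Finset.univ I.agentPos ⟨R.al, Finset.mem_univ _⟩
  set c := I.agentPos a₀ with hc
  let W : Agent n → ℝ := fun a => max (I.itemPos (favorite P a)) c
  let π : Equiv.Perm (Fin n) := R.agentOrder
  let ρ : Equiv.Perm (Fin n) := γ.trans O.symm
  have hOρ : ∀ i, O (ρ i) = γ i := fun i => O.apply_symm_apply _
  have hx : ∀ a, c ≤ I.agentPos a := fun a => ha₀ a (Finset.mem_univ a)
  have hfav := R.itemPos_favorite_mem hI hlr.le
  have hcR : c ≤ I.itemPos R.gr := by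
    have := I.le_midpoint_of_d_le hlr (hI.d_top_le R.top_al _)
    linarith [hx R.al]
  have hWR : ∀ a, W a ≤ I.itemPos R.gr := fun a => max_le (hfav a).2 hcR
  have hWL : ∀ a, I.itemPos R.gl ≤ W a := fun a => le_max_of_le_left (hfav a).1
  have hWd : ∀ a g, |I.agentPos a - W a| ≤ I.d a g := fun a g =>
    (abs_sub_max_le (hx a)).trans (hI.d_top_le (isTop_favorite P a) g)
  have hmax : Monotone fun t : ℝ => max t c := fun s t hst => max_le_max hst le_rfl
  have hπ : Monotone (W ∘ π) := hmax.comp (R.monotone_favorite_agentOrder hI hlr)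
  have hρ : Monotone (W ∘ ρ) := by
    refine hmax.comp (f := fun i => I.itemPos (favorite P (ρ i))) fun i j hij => ?_
    refine hI.itemPos_favorite_le (not_lt.1 fun hlt => ?_)
    have := hO _ _ hlt
    rw [hOρ, hOρ] at this
    exact not_lt.2 (hγ.monotone hij) this
  -- `π` and `ρ` may differ among agents with equal proxies, but sorted lists of the same values
  -- agree place by place.
  have hπρ : W ∘ π = W ∘ ρ := Tuple.unique_monotone hπ hρ
  let m : Fin n → ℝ := fun i =>
    if h : (i : ℕ) < R.itemOrder.length then |I.agentPos (π i) - W (π ⟨i + p, by omega⟩)|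
    else |I.agentPos (π i) - W (π i)|
  refine centrumCost_le_three_mul hk hkn R.matching O π m (fun i => ?_) fun θ _ => ?_
  · set g := R.matching (π i) with hg
    by_cases h : (i : ℕ) < R.itemOrder.length
    · simp only [m, dif_pos h]
      have hgγ : g = γ ⟨i + p, by omega⟩ := (R.matching_spec i h).trans (hγL i h).symm
      have hb : O.symm g = ρ ⟨i + p, by omega⟩ := by rw [hgγ]; rfl
      have hw : W (π ⟨i + p, by omega⟩) = W (O.symm g) := by
        rw [hb]; exact congrFun hπρ _
      rw [hw]
      have h1 := hWd (O.symm g) g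
      have h2 : I.d (π i) g ≤ |I.agentPos (π i) - W (O.symm g)| + |W (O.symm g) - I.itemPos g| :=
        abs_sub_le _ _ _
      have h3 : |W (O.symm g) - I.itemPos g|
          ≤ |I.agentPos (O.symm g) - W (O.symm g)| + I.d (O.symm g) g := by
        have := abs_sub_le (W (O.symm g)) (I.agentPos (O.symm g)) (I.itemPos g)
        rwa [abs_sub_comm (W (O.symm g)) (I.agentPos (O.symm g))] at this
      linarith
    · simp only [m, dif_neg h]
      have hgin := R.matching_notMem (not_lt.1 h)
      have h2 : I.d (π i) g ≤ |I.agentPos (π i) - W (π i)| + |W (π i) - I.itemPos g| :=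
        abs_sub_le _ _ _
      -- The proxy lies between `gl` and `gr`, and the `O`-owner of `g` is no closer to `g` than to
      -- the opposite extreme item, which is thus within twice its distance from `g`.
      have h3 : |W (π i) - I.itemPos g| ≤ 2 * I.d (O.symm g) g := by
        have hwl := hWL (π i)
        have hwr := hWR (π i)
        rcases R.outside hI hlr hgin with hgl | hgr
        · have h4 := I.midpoint_le_of_d_le (hgl.trans hlr)
            (R.d_right_le hI hlr hgin hgl (O.symm g))
          have h5 : I.agentPos (O.symm g) - I.itemPos g ≤ I.d (O.symm g) g := le_abs_self _
          change I.itemPos g < _ at hgl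
          change I.itemPos g + _ ≤ _ at h4
          rw [abs_of_nonneg (by linarith)]
          linarith
        · have h4 := I.le_midpoint_of_d_le (hlr.trans hgr)
            (R.d_left_le hI hlr hgin hgr (O.symm g))
          have h5 : -(I.agentPos (O.symm g) - I.itemPos g) ≤ I.d (O.symm g) g := neg_le_abs _
          change _ < I.itemPos g at hgr
          change _ ≤ _ + I.itemPos g at h4
          rw [abs_of_nonpos (by linarith)]
          linarith
      linarith
  · refine sum_excess_shift_le (p := p) (by omega) I.agentPos W (fun a => I.d a (O a)) m c
      (I.itemPos R.gr) π ρ hπ hπρ hx (fun a => le_max_right _ _) hWR (fun a => hWd a _) ?_ ?_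
    · intro r hr
      obtain ⟨h1, h2⟩ := hγX r hr
      -- Even the leftmost agent is no closer to `γ r` than to `gr`, so `γ r` is at most `2 * c`
      -- minus the position of `gr`.
      have h3 := I.midpoint_le_of_d_le (h2.trans hlr) (R.d_right_le hI hlr h1 h2 a₀)
      have h4 : I.agentPos (ρ r) - I.itemPos (γ r) ≤ I.d (ρ r) (γ r) := le_abs_self _
      rw [hOρ]
      linarith
    · intro i
      by_cases h : (i : ℕ) < R.itemOrder.length
      · exact Or.inr ⟨by omega, by simp only [m, dif_pos h, le_refl]⟩
      · exact Or.inl (by simp only [m, dif_neg h, le_refl])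

theorem OrderMatchRun.centrumCost_le (hI : Consistent I P) (R : OrderMatchRun P) {k : ℕ}
    (hk : 1 ≤ k) (hkn : k ≤ n) : centrumCost k I R.matching ≤ 3 * optCost k I := by
  rcases lt_trichotomy (I.itemPos R.gl) (I.itemPos R.gr) with h | h | h
  · obtain ⟨O, hO, hmono⟩ := exists_monotone_optimal hk hkn I
    rw [hO]
    exact R.centrumCost_le_of_lt hI h hk hkn O hmono
  · obtain ⟨O, hO, -⟩ := exists_monotone_optimal hk hkn I
    rw [hO]
    exact R.centrumCost_le_of_eq hI (I.item_injective h) hk hkn O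
  · obtain ⟨O, hO, hmono⟩ := exists_monotone_optimal hk hkn I.reflect
    rw [← I.reflect_optCost, ← I.reflect_centrumCost, hO]
    exact R.centrumCost_le_of_lt hI.reflect (neg_lt_neg h) hk hkn O hmono

theorem centrumCost_nonneg (k : ℕ) (I : LineInstance n) (M : Matching n) :
    0 ≤ centrumCost k I M := by
  refine List.sum_nonneg fun x hx => ?_
  have := List.mem_of_mem_take hx
  rw [Multiset.mem_sort, Multiset.mem_map] at this
  obtain ⟨a, -, rfl⟩ := this
  exact I.d_nonneg _ _

theorem optCost_nonneg (k : ℕ) (I : LineInstance n) : 0 ≤ optCost k I :=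
  (Finset.le_inf'_iff _ _).2 fun M _ => centrumCost_nonneg k I M

theorem IsOrderMatch.distortion_le {ALG : Algorithm n} (h : IsOrderMatch ALG) {k : ℕ}
    (hk : 1 ≤ k) (hkn : k ≤ n) : distortion k ALG ≤ 3 := by
  refine iSup_le fun P => iSup_le fun I => iSup_le fun hI => ?_
  obtain ⟨R, hR⟩ := h P ⟨I, hI⟩
  rw [← hR, show (3 : ℝ≥0∞) = ENNReal.ofReal 3 by simp]
  exact ENNReal.ofReal_le_ofReal
    (div_le_of_le_mul₀ (optCost_nonneg k I) (by norm_num) (R.centrumCost_le hI hk hkn))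

end UpperBound

section LowerBound

/-! ### Lower bounds -/

theorem exists_strictMono_between (n : ℕ) {δ : ℝ} (hδ : 0 < δ) :
    ∃ u : Fin n → ℝ, StrictMono u ∧ ∀ i, 0 < u i ∧ u i < δ := by
  have hn : (0 : ℝ) < n + 1 := by positivity
  refine ⟨fun i => δ * ((i + 1) / (n + 1)), fun i j hij => ?_, fun i => ⟨by positivity, ?_⟩⟩
  · have : ((i : ℕ) : ℝ) < (j : ℕ) := by exact_mod_cast hij
    exact mul_lt_mul_of_pos_left (div_lt_div_of_pos_right (by linarith) hn) hδ
  · have : ((i : ℕ) : ℝ) < n := by exact_mod_cast i.2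
    have h1 : (((i : ℕ) : ℝ) + 1) / (n + 1) < 1 := (div_lt_one hn).2 (by linarith)
    nlinarith

/-- The profile in which all agents rank the items in the same way. -/
def commonProfile (n : ℕ) : Profile n := fun _ => Equiv.refl _

variable {n : ℕ}

theorem optCost_le (k : ℕ) (I : LineInstance n) (M : Matching n) :
    optCost k I ≤ centrumCost k I M := Finset.inf'_le _ (Finset.mem_univ M)

theorem d_le_centrumCost {k : ℕ} (hk : 1 ≤ k) (hkn : k ≤ n) (I : LineInstance n) (M : Matching n)
    (a : Agent n) : I.d a (M a) ≤ centrumCost k I M := by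
  have := sum_le_topSum hk hkn (fun a => I.d a (M a)) (fun _ => I.d_nonneg _ _) {a} (by simpa)
  rwa [Finset.sum_singleton] at this

theorem d_add_d_le_centrumCost {k : ℕ} (hk : 2 ≤ k) (hkn : k ≤ n) (I : LineInstance n)
    (M : Matching n) {a b : Agent n} (hab : a ≠ b) :
    I.d a (M a) + I.d b (M b) ≤ centrumCost k I M := by
  have := sum_le_topSum (by omega) hkn (fun a => I.d a (M a)) (fun _ => I.d_nonneg _ _) {a, b}
    (by rw [Finset.card_pair hab]; exact hk)
  rwa [Finset.sum_pair hab] at this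

/-- The distinguished agent is at distance one from the favorite item and at distance three from
all others; the other agents are halfway between the favorite item and the others. -/
theorem exists_hard_instance_egalitarian (hn : 1 ≤ n) (a : Agent n) {ε : ℝ} (hε : 0 < ε) :
    ∃ I : LineInstance n, Consistent I (commonProfile n) ∧ optCost 1 I ≤ 1 + ε ∧
      ∀ M : Matching n, 1 ≤ centrumCost 1 I M ∧
        (M a ≠ (⟨0, hn⟩ : Fin n) → 3 ≤ centrumCost 1 I M) := by
  classical
  -- The offsets make the positions distinct; two of them together add less than `ε` to a distance.
  obtain ⟨u, hu, hub⟩ := exists_strictMono_between n (δ := min ε 1 / 2) (by positivity)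
  have hε1 : min ε 1 ≤ ε := min_le_left _ _
  have hε2 : min ε 1 ≤ 1 := min_le_right _ _
  set z : Fin n := ⟨0, hn⟩ with hz
  let x : Agent n → ℝ := fun b => if b = a then -1 else 1 - u b
  let y : Item n → ℝ := fun g => if g = z then 0 else 2 + u g
  have hxa : x a = -1 := if_pos rfl
  have hxb : ∀ b, b ≠ a → x b = 1 - u b := fun b hb => if_neg hb
  have hyz : y z = 0 := if_pos rfl
  have hyg : ∀ g, g ≠ z → y g = 2 + u g := fun g hg => if_neg hg
  have hmono : StrictMono y := by
    intro g h hgh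
    have hh : h ≠ z := fun e => by rw [e] at hgh; exact absurd hgh (Nat.not_lt_zero _)
    rw [hyg h hh]
    by_cases hg : g = z
    · rw [hg, hyz]; linarith [(hub h).1]
    · rw [hyg g hg]; linarith [hu hgh]
  let I : LineInstance n :=
    { agentPos := x
      itemPos := y
      agent_injective := by
        intro b b' h
        by_cases h1 : b = a <;> by_cases h2 : b' = a
        · rw [h1, h2]
        · rw [h1, hxa, hxb b' h2] at h; linarith [(hub b').2]
        · rw [h2, hxa, hxb b h1] at h; linarith [(hub b).2]
        · rw [hxb b h1, hxb b' h2] at h; exact hu.injective (by linarith)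
      item_injective := hmono.injective
      agent_ne_item := by
        intro b g h
        by_cases h1 : b = a <;> by_cases h2 : g = z
        · rw [h1, h2, hxa, hyz] at h; linarith
        · rw [h1, hxa, hyg g h2] at h; linarith [(hub g).1]
        · rw [h2, hyz, hxb b h1] at h; linarith [(hub b).2]
        · rw [hxb b h1, hyg g h2] at h; linarith [(hub b).1, (hub g).1] }
  have hdaz : I.d a z = 1 := by
    change |x a - y z| = 1
    rw [hxa, hyz]; norm_num
  have hda : ∀ g, g ≠ z → 3 ≤ I.d a g := by
    intro g hg
    change 3 ≤ |x a - y g|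
    rw [hxa, hyg g hg, abs_of_neg (by linarith [(hub g).1])]
    linarith [(hub g).1]
  have hdbz : ∀ b, b ≠ a → I.d b z ≤ 1 := by
    intro b hb
    change |x b - y z| ≤ 1
    rw [hxb b hb, hyz, abs_of_pos (by linarith [(hub b).2])]
    linarith [(hub b).1]
  have hdb : ∀ b g, b ≠ a → g ≠ z → I.d b g = 1 + u b + u g := by
    intro b g hb hg
    change |x b - y g| = _
    rw [hxb b hb, hyg g hg, abs_of_neg (by linarith [(hub b).1, (hub g).1])]
    ring
  refine ⟨I, ?_, ?_, fun M => ?_⟩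
  · intro b g h hgh
    have hgh' : g < h := hgh
    by_cases hb : b = a
    · subst hb
      change |x b - y g| ≤ |x b - y h|
      have h1 : 0 ≤ y g := hyz ▸ hmono.monotone (show z ≤ g from Nat.zero_le _)
      have h2 := hmono hgh'
      rw [hxa, abs_of_neg (by linarith), abs_of_neg (by linarith)]
      linarith
    · have hh : h ≠ z := fun e => by rw [e] at hgh'; exact absurd hgh' (Nat.not_lt_zero _)
      rw [hdb b h hb hh]
      by_cases hg : g = z
      · rw [hg]; linarith [hdbz b hb, (hub b).1, (hub h).1]
      · rw [hdb b g hb hg]; linarith [hu hgh']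
  · let O : Matching n := Equiv.swap a z
    refine (optCost_le 1 I O).trans ?_
    have h1 := topSum_le 1 (fun b => I.d b (O b)) (θ := 1 + ε) (by linarith)
    rw [Finset.sum_eq_zero] at h1
    · simpa [centrumCost_eq_topSum] using h1
    · intro b _
      refine max_eq_right (sub_nonpos.2 ?_)
      by_cases hb : b = a
      · rw [hb, show O a = z from Equiv.swap_apply_left a z, hdaz]; linarith
      · by_cases hg : O b = z
        · rw [hg]; linarith [hdbz b hb]
        · rw [hdb b _ hb hg]; linarith [(hub b).2, (hub (O b)).2]
  · have h1 := d_le_centrumCost le_rfl hn I M a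
    by_cases h : M a = z
    · rw [h, hdaz] at h1
      exact ⟨h1, fun h' => absurd h h'⟩
    · have := hda _ h
      exact ⟨by linarith, fun _ => by linarith⟩

/-- The distinguished agent is halfway between the last item and the other items; the other agents
are close to the other items. -/
theorem exists_hard_instance_of_two_le {k : ℕ} (hk : 2 ≤ k) (hkn : k ≤ n) (a : Agent n) {ε : ℝ}
    (hε : 0 < ε) :
    ∃ I : LineInstance n, Consistent I (commonProfile n) ∧ optCost k I ≤ 1 + ε ∧
      ∀ M : Matching n, 1 ≤ centrumCost k I M ∧
        (M a ≠ (⟨n - 1, by omega⟩ : Fin n) → 3 ≤ centrumCost k I M) := by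
  classical
  have hn0 : (0 : ℝ) < n := by exact_mod_cast (by omega : 0 < n)
  -- The good matching costs at most `1 + δ` for `a` plus `2 * δ` per agent, in total `1 + min ε 1`.
  set δ : ℝ := min ε 1 / (2 * n + 1) with hδ
  have hδ0 : 0 < δ := by positivity
  have hδn : δ * (2 * n + 1) = min ε 1 := div_mul_cancel₀ _ (by positivity)
  have hε1 : min ε 1 ≤ ε := min_le_left _ _
  have hε2 : min ε 1 ≤ 1 := min_le_right _ _
  have hn2 : (2 : ℝ) ≤ n := by exact_mod_cast (by omega : 2 ≤ n)
  have hδ1 : δ ≤ 1 / 2 := by nlinarith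
  obtain ⟨u, hu, hub⟩ := exists_strictMono_between n hδ0
  set z : Fin n := ⟨n - 1, by omega⟩ with hz
  have hlast : ∀ g : Fin n, g ≤ z := fun g => by
    rw [hz, Fin.le_def]; have := g.2; simp only; omega
  let x : Agent n → ℝ := fun b => if b = a then 1 else u b
  -- The extra `δ` makes `z` the farthest item even for `a` and keeps it at distance above 2 from
  -- all other agents.
  let y : Item n → ℝ := fun g => if g = z then 2 + δ else -u g
  have hxa : x a = 1 := if_pos rfl
  have hxb : ∀ b, b ≠ a → x b = u b := fun b hb => if_neg hb
  have hyz : y z = 2 + δ := if_pos rfl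
  have hyg : ∀ g, g ≠ z → y g = -u g := fun g hg => if_neg hg
  let I : LineInstance n :=
    { agentPos := x
      itemPos := y
      agent_injective := by
        intro b b' h
        by_cases h1 : b = a <;> by_cases h2 : b' = a
        · rw [h1, h2]
        · rw [h1, hxa, hxb b' h2] at h; linarith [(hub b').2]
        · rw [h2, hxa, hxb b h1] at h; linarith [(hub b).2]
        · rw [hxb b h1, hxb b' h2] at h; exact hu.injective h
      item_injective := by
        intro g g' h
        by_cases h1 : g = z <;> by_cases h2 : g' = z
        · rw [h1, h2]
        · rw [h1, hyz, hyg g' h2] at h; linarith [(hub g').1]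
        · rw [h2, hyz, hyg g h1] at h; linarith [(hub g).1]
        · rw [hyg g h1, hyg g' h2] at h; exact hu.injective (neg_injective h)
      agent_ne_item := by
        intro b g h
        by_cases h1 : b = a <;> by_cases h2 : g = z
        · rw [h1, h2, hxa, hyz] at h; linarith
        · rw [h1, hxa, hyg g h2] at h; linarith [(hub g).1]
        · rw [h2, hyz, hxb b h1] at h; linarith [(hub b).2]
        · rw [hxb b h1, hyg g h2] at h; linarith [(hub b).1, (hub g).1] }
  have hdaz : I.d a z = 1 + δ := by
    change |x a - y z| = _
    rw [hxa, hyz, abs_of_neg (by linarith)]; ring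
  have hda : ∀ g, g ≠ z → I.d a g = 1 + u g := by
    intro g hg
    change |x a - y g| = _
    rw [hxa, hyg g hg, abs_of_pos (by linarith [(hub g).1])]; ring
  have hdbz : ∀ b, b ≠ a → I.d b z = 2 + δ - u b := by
    intro b hb
    change |x b - y z| = _
    rw [hxb b hb, hyz, abs_of_neg (by linarith [(hub b).2])]; ring
  have hdb : ∀ b g, b ≠ a → g ≠ z → I.d b g = u b + u g := by
    intro b g hb hg
    change |x b - y g| = _
    rw [hxb b hb, hyg g hg, abs_of_pos (by linarith [(hub b).1, (hub g).1])]; ring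
  refine ⟨I, ?_, ?_, fun M => ?_⟩
  · intro b g h hgh
    have hgh' : g < h := hgh
    have hg : g ≠ z := fun e => not_lt.2 (hlast h) (e ▸ hgh')
    have hug := hub g
    have hub' := hub b
    have hlt := hu hgh'
    by_cases hb : b = a <;> by_cases hh : h = z
    · rw [hb, hh, hdaz, hda g hg]; linarith
    · rw [hb, hda h hh, hda g hg]; linarith
    · rw [hh, hdbz b hb, hdb b g hb hg]; linarith
    · rw [hdb b g hb hg, hdb b h hb hh]; linarith
  · let O : Matching n := Equiv.swap a z
    have hOa : O a = z := Equiv.swap_apply_left a z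
    refine (optCost_le k I O).trans ?_
    have h1 := topSum_le k (fun b => I.d b (O b)) (θ := 0) le_rfl
    have h2 : ∀ b, excess 0 (I.d b (O b)) ≤ (if b = a then 1 + δ else 0) + 2 * δ := by
      intro b
      rw [excess, sub_zero, max_eq_left (I.d_nonneg _ _)]
      by_cases hb : b = a
      · rw [if_pos hb, hb, hOa, hdaz]; linarith
      · have hg : O b ≠ z := fun e => hb (O.injective (e.trans hOa.symm))
        rw [if_neg hb, hdb b _ hb hg]; linarith [(hub b).2, (hub (O b)).2]
    have h3 := Finset.sum_le_sum fun b (_ : b ∈ Finset.univ) => h2 b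
    rw [Finset.sum_add_distrib, Finset.sum_ite_eq' Finset.univ a] at h3
    simp only [Finset.mem_univ, if_true, Finset.sum_const, Finset.card_univ, Fintype.card_fin,
      nsmul_eq_mul] at h3
    rw [centrumCost_eq_topSum]
    nlinarith
  · by_cases h : M a = z
    · have h1 := d_le_centrumCost (by omega) hkn I M a
      rw [h, hdaz] at h1
      exact ⟨by linarith, fun h' => absurd h h'⟩
    -- Another agent then travels more than 2 to `z`, and `a` still travels more than 1; counting
    -- both needs `k ≥ 2`.
    · have hb : M.symm z ≠ a := fun e => h (by rw [← e, M.apply_symm_apply])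
      have h1 := d_add_d_le_centrumCost hk hkn I M hb
      rw [M.apply_symm_apply, hdbz _ hb, hda _ h] at h1
      have h2 := (hub (M.symm z)).2
      have h3 := (hub (M a)).1
      exact ⟨by linarith, fun _ => by linarith⟩

/-- The profile and the item are fixed before the agent, so the agent can be chosen in view of the
output of the algorithm. -/
theorem exists_hard_instances {k : ℕ} (hk : 1 ≤ k) (hkn : k ≤ n) :
    ∃ (P : Profile n) (g : Item n), ∀ (a : Agent n) (ε : ℝ), 0 < ε →
      ∃ I : LineInstance n, Consistent I P ∧ optCost k I ≤ 1 + ε ∧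
        ∀ M : Matching n, 1 ≤ centrumCost k I M ∧ (M a ≠ g → 3 ≤ centrumCost k I M) := by
  rcases hk.eq_or_lt with rfl | hk
  · exact ⟨commonProfile n, ⟨0, hkn⟩, fun a ε hε => exists_hard_instance_egalitarian hkn a hε⟩
  · exact ⟨commonProfile n, ⟨n - 1, by omega⟩,
      fun a ε hε => exists_hard_instance_of_two_le hk hkn a hε⟩

/-- The hard instances only bound the optimum by `1 + ε`, so the ratio is obtained as a limit within
the supremum. -/
theorem ofReal_le_of_forall_div {r : ℝ} {D : ℝ≥0∞}
    (h : ∀ ε : ℝ, 0 < ε → ENNReal.ofReal (r / (1 + ε)) ≤ D) : ENNReal.ofReal r ≤ D := by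
  have hlim : Filter.Tendsto (fun ε : ℝ => ENNReal.ofReal (r / (1 + ε)))
      (nhdsWithin 0 (Set.Ioi 0)) (nhds (ENNReal.ofReal r)) := by
    refine ENNReal.tendsto_ofReal (Filter.Tendsto.mono_left ?_ nhdsWithin_le_nhds)
    have : ContinuousAt (fun ε : ℝ => r / (1 + ε)) 0 :=
      continuousAt_const.div (by fun_prop) (by norm_num)
    simpa [ContinuousAt] using this
  exact le_of_tendsto hlim (Filter.eventually_of_mem self_mem_nhdsWithin h)

theorem div_one_add_le_div_optCost {k : ℕ} {I : LineInstance n} {ε r c : ℝ} (hr : r ≤ c)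
    (hc : 0 ≤ c) (hopt : optCost k I ≤ 1 + ε) (h : ∀ M, 1 ≤ centrumCost k I M) :
    r / (1 + ε) ≤ c / optCost k I := by
  have h1 : 1 ≤ optCost k I := (Finset.le_inf'_iff _ _).2 fun M _ => h M
  exact (div_le_div_of_nonneg_right hr (by linarith)).trans
    (div_le_div_of_nonneg_left hc (by linarith) hopt)

theorem three_le_distortion (hn : 2 ≤ n) {k : ℕ} (hk : 1 ≤ k) (hkn : k ≤ n) (ALG : Algorithm n) :
    3 ≤ distortion k ALG := by
  obtain ⟨P, g, h⟩ := exists_hard_instances hk hkn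
  have : Nontrivial (Fin n) := Fin.nontrivial_iff_two_le.2 hn
  obtain ⟨a, ha⟩ := exists_ne ((ALG P).symm g)
  have hag : ALG P a ≠ g := fun e => ha ((Equiv.eq_symm_apply _).2 e)
  rw [show (3 : ℝ≥0∞) = ENNReal.ofReal 3 by simp]
  refine ofReal_le_of_forall_div fun ε hε => ?_
  obtain ⟨I, hI, hopt, hM⟩ := h a ε hε
  refine le_trans (ENNReal.ofReal_le_ofReal ?_)
    (le_iSup_of_le P (le_iSup_of_le I (le_iSup_of_le hI le_rfl)))
  exact div_one_add_le_div_optCost ((hM _).2 hag) (centrumCost_nonneg _ _ _) hopt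
    fun M => (hM M).1

theorem sum_toReal_pmf (μ : PMF (Matching n)) : ∑ M, (μ M).toReal = 1 := by
  rw [← ENNReal.toReal_sum fun M _ => μ.apply_ne_top M, ← tsum_fintype (L := .unconditional _),
    μ.tsum_coe, ENNReal.toReal_one]

/-- Some agent receives a given item with probability at most `1 / n`. -/
theorem exists_agent_prob_le (hn : 1 ≤ n) (μ : PMF (Matching n)) (g : Item n) :
    ∃ a : Agent n, ∑ M : Matching n, (if M a = g then (μ M).toReal else 0) ≤ 1 / n := by
  have hsum : ∑ a : Agent n, ∑ M : Matching n, (if M a = g then (μ M).toReal else 0)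
      = ∑ _a : Agent n, (1 / n : ℝ) := by
    rw [Finset.sum_comm, Finset.sum_const, Finset.card_univ, Fintype.card_fin, nsmul_eq_mul,
      mul_one_div_cancel (by positivity), ← sum_toReal_pmf μ]
    refine Finset.sum_congr rfl fun M _ => ?_
    simp only [← Equiv.eq_symm_apply]
    rw [Finset.sum_ite_eq' Finset.univ (M.symm g), if_pos (Finset.mem_univ _)]
  obtain ⟨a, -, ha⟩ := Finset.exists_le_of_sum_le ⟨⟨0, hn⟩, Finset.mem_univ _⟩ hsum.le
  exact ⟨a, ha⟩

theorem le_randomizedDistortion {k : ℕ} (hk : 1 ≤ k) (hkn : k ≤ n)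
    (ALG : RandomizedAlgorithm n) :
    ENNReal.ofReal (3 - 2 / (n : ℝ)) ≤ randomizedDistortion k ALG := by
  obtain ⟨P, g, h⟩ := exists_hard_instances hk hkn
  have hn : 1 ≤ n := hk.trans hkn
  obtain ⟨a, ha⟩ := exists_agent_prob_le hn (ALG P) g
  refine ofReal_le_of_forall_div fun ε hε => ?_
  obtain ⟨I, hI, hopt, hM⟩ := h a ε hε
  refine le_trans (ENNReal.ofReal_le_ofReal ?_)
    (le_iSup_of_le P (le_iSup_of_le I (le_iSup_of_le hI le_rfl)))
  refine div_one_add_le_div_optCost ?_ (Finset.sum_nonneg fun M _ =>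
    mul_nonneg ENNReal.toReal_nonneg (centrumCost_nonneg _ _ _)) hopt fun M => (hM M).1
  -- Every matching costs at least 3, minus 2 if `a` receives `g`, an event of probability at most
  -- `1 / n`.
  have hterm : ∀ M : Matching n,
      3 * (ALG P M).toReal - 2 * (if M a = g then (ALG P M).toReal else 0)
        ≤ (ALG P M).toReal * centrumCost k I M := by
    intro M
    have h0 : 0 ≤ (ALG P M).toReal := ENNReal.toReal_nonneg
    by_cases hMa : M a = g
    · rw [if_pos hMa]; nlinarith [(hM M).1]
    · rw [if_neg hMa]; nlinarith [(hM M).2 hMa]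
  have hsum := Finset.sum_le_sum fun M (_ : M ∈ Finset.univ) => hterm M
  rw [Finset.sum_sub_distrib, ← Finset.mul_sum, ← Finset.mul_sum, sum_toReal_pmf] at hsum
  have h2 : 2 / (n : ℝ) = 2 * (1 / n) := by ring
  rw [expectedCentrumCost, h2]
  linarith

end LowerBound

end LineMatching

end

theorem mainTheorem1 (n : ℕ) (hn : 1 ≤ n) :
    -- OrderMatch is a well-defined deterministic ordinal algorithm
    (∃ ALG : LineMatching.Algorithm n, LineMatching.IsOrderMatch ALG) ∧
    -- and the item ordering that it computes from the profile is the true one (up to reversal)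
    (∀ (P : LineMatching.Profile n) (I : LineMatching.LineInstance n),
      LineMatching.Consistent I P → ∀ R : LineMatching.OrderMatchRun P,
        LineMatching.IsTrueOrder I R.itemOrder) ∧
    -- its distortion is at most 3, simultaneously for all `k`
    (∀ ALG : LineMatching.Algorithm n, LineMatching.IsOrderMatch ALG →
      ∀ k : ℕ, 1 ≤ k → k ≤ n → LineMatching.distortion k ALG ≤ 3) ∧
    -- no deterministic algorithm has smaller distortion, for any `k`
    (2 ≤ n → ∀ k : ℕ, 1 ≤ k → k ≤ n → ∀ ALG : LineMatching.Algorithm n,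
      3 ≤ LineMatching.distortion k ALG) ∧
    -- no randomized algorithm has distortion smaller than `3 - 2 / n`, for any `k`
    (∀ k : ℕ, 1 ≤ k → k ≤ n → ∀ ALG : LineMatching.RandomizedAlgorithm n,
      ENNReal.ofReal (3 - 2 / (n : ℝ)) ≤ LineMatching.randomizedDistortion k ALG) := by
  exact ⟨LineMatching.exists_isOrderMatch hn, fun _ _ hI R => R.isTrueOrder hI,
    fun _ h _ hk hkn => h.distortion_le hk hkn,
    fun hn2 _ hk hkn ALG => LineMatching.three_le_distortion hn2 hk hkn ALG,
    fun _ hk hkn ALG => LineMatching.le_randomizedDistortion hk hkn ALG⟩
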